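/- A partial linear space is a non-empty point set $P$ with a family of proper subsets of $P$ (lines), each containing at least two points, such that every point is on a line and two distinct points are on at most one common line; points are collinear if some line contains them (so a point is collinear to itself). A subspace is a set of points containing the line through any two of its distinct collinear points; it is singular if any two of its points are collinear. A polar space is a partial linear space such that every line has at least three points, no point is collinear to all points, each point is collinear to exactly one or to all points of each line, and every chain of singular subspaces is finite; it has rank $n$ if its maximal singular subspaces have (projective) dimension $n-1$. For $n\ge 2$, a thin polar space of rank $n$ is a partial linear space isomorphic to the one with points $\pm1,\dots,\pm n$ whose lines are all the sets $\{i,j\}$ with $j\ne \pm i$; its singular subspaces $S$ have dimension $|S|-1$. For a polar space or thin polar space $\Pi$ of rank $n$ and $0\le k\le n-1$, let $\mathcal G_k(\Pi)$ be the set of $k$-dimensional singular subspaces, and let $\Gamma_k(\Pi)$ be the graph on $\mathcal G_k(\Pi)$ in which two distinct elements are adjacent if they lie in a common $(k+1)$-dimensional singular subspace (when $k\le n-2$), or if their intersection is $(n-2)$-dimensional (when $k=n-1$). Write $\Gamma_k(n)$ for $\Gamma_k$ of a thin polar space of rank $n$. A frame of $\Pi$ is a set of $2n$ points each of which is non-collinear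 to exactly one point of the set; the apartment of $\mathcal G_k(\Pi)$ associated to a frame consists of all $k$-dimensional singular subspaces spanned by subsets of the frame. Corollary 1. Let $\Pi$ be a polar space or a thin polar space of rank $n$ and let $0\le k\le n-1$. Then the image of every isometric embedding of $\Gamma_k(n)$ in $\Gamma_k(\Pi)$ (an injection of the vertex sets that preserves adjacency, non-adjacency and distance) is an apartment of $\mathcal G_k(\Pi)$. -/

import Mathlib

/-- A partial linear space on the point set `P`: a non-empty set of points together with a family
of proper subsets, called lines, such that every line contains at least two points, every point is
on a line, and two distinct points are on at most one common line. -/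
structure PartialLinearSpace (P : Type*) where
  lines : Set (Set P)
  nonempty : Nonempty P
  ne_univ : ∀ L ∈ lines, L ≠ Set.univ
  two_le : ∀ L ∈ lines, 2 ≤ L.encard
  exists_line : ∀ p : P, ∃ L ∈ lines, p ∈ L
  line_unique : ∀ p q : P, p ≠ q → ∀ L ∈ lines, ∀ M ∈ lines,
    p ∈ L → q ∈ L → p ∈ M → q ∈ M → L = M

namespace PartialLinearSpace

variable {P Q : Type*}

/-- Two points are collinear if some line contains both of them; every point is collinear
to itself. -/
def Collinear (X : PartialLinearSpace P) (p q : P) : Prop :=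
  ∃ L ∈ X.lines, p ∈ L ∧ q ∈ L

/-- A subspace contains the line joining any two of its distinct collinear points. -/
def IsSubspace (X : PartialLinearSpace P) (S : Set P) : Prop :=
  ∀ p ∈ S, ∀ q ∈ S, p ≠ q → ∀ L ∈ X.lines, p ∈ L → q ∈ L → L ⊆ S

/-- A singular subspace is a subspace any two points of which are collinear. -/
def IsSingularSubspace (X : PartialLinearSpace P) (S : Set P) : Prop :=
  X.IsSubspace S ∧ ∀ p ∈ S, ∀ q ∈ S, X.Collinear p q

/-- The singular subspaces, ordered by inclusion. -/
abbrev SingularSubspace (X : PartialLinearSpace P) : Type _ :=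
  {S : Set P // X.IsSingularSubspace S}

/-- The intersection of two singular subspaces. -/
def SingularSubspace.inter {X : PartialLinearSpace P} (S T : X.SingularSubspace) :
    X.SingularSubspace :=
  ⟨S.1 ∩ T.1,
    fun p hp q hq hpq L hL hpL hqL => Set.subset_inter
      (S.2.1 p hp.1 q hq.1 hpq L hL hpL hqL) (T.2.1 p hp.2 q hq.2 hpq L hL hpL hqL),
    fun p hp q hq => S.2.2 p hp.1 q hq.1⟩

/-- The subspace spanned by a set of points: the smallest subspace containing it. -/
def span (X : PartialLinearSpace P) (A : Set P) : Set P :=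
  ⋂₀ {S | X.IsSubspace S ∧ A ⊆ S}

/-- `S` has projective dimension `d`: the longest chains of singular subspaces
`∅ ⊂ S₀ ⊂ S₁ ⊂ ⋯ ⊂ S_d = S` ending in `S` have exactly `d + 1` steps. So the empty subspace has
dimension `-1`, a point has dimension `0`, and a projective space or a simplex has its usual
dimension. -/
def SingularSubspace.HasDim {X : PartialLinearSpace P} (S : X.SingularSubspace) (d : ℤ) : Prop :=
  ∃ h : ℕ, Order.height S = (h : ℕ∞) ∧ (h : ℤ) = d + 1

/-- The axioms of a polar space. -/
structure IsPolarSpace (X : PartialLinearSpace P) : Prop where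
  /-- every line contains at least three points -/
  three_le : ∀ L ∈ X.lines, 3 ≤ L.encard
  /-- no point is collinear to all points -/
  nondegenerate : ¬ ∃ p : P, ∀ q : P, X.Collinear p q
  /-- every point is collinear to exactly one or to all points of every line -/
  one_or_all : ∀ p : P, ∀ L ∈ X.lines,
    (∃! q : P, q ∈ L ∧ X.Collinear p q) ∨ (∀ q ∈ L, X.Collinear p q)
  /-- chains of singular subspaces are finite -/
  finite_chain : ∀ C : Set X.SingularSubspace, IsChain (· ≤ ·) C → C.Finite

/-- The rank is `n`: all maximal singular subspaces have dimension `n - 1`. -/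
def HasRank (X : PartialLinearSpace P) (n : ℕ) : Prop :=
  ∀ M : X.SingularSubspace, IsMax M → M.HasDim ((n : ℤ) - 1)

/-- The antipode `-i` of a point `i` of the standard thin polar space; the pairs
`(i, true)` and `(i, false)` stand for `+i` and `-i`. -/
def antipode {n : ℕ} (i : Fin n × Bool) : Fin n × Bool := (i.1, !i.2)

/-- The standard thin polar space of rank `n ≥ 2`: the points are `±1, …, ±n`, the lines are all
two-element sets `{i, j}` with `j ≠ -i`. -/
def thinPolarSpace (n : ℕ) (hn : 2 ≤ n) : PartialLinearSpace (Fin n × Bool) where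
  lines := {L | ∃ i j, i ≠ j ∧ j ≠ antipode i ∧ L = {i, j}}
  nonempty := ⟨(⟨0, by omega⟩, true)⟩
  ne_univ := by
    rintro L ⟨i, j, hij, hj, rfl⟩ h
    have hi : antipode i ∈ ({i, j} : Set (Fin n × Bool)) := h ▸ Set.mem_univ _
    rcases hi with hi | hi
    · have := congrArg Prod.snd hi
      simp [antipode] at this
    · exact hj hi.symm
  two_le := by
    rintro L ⟨i, j, hij, -, rfl⟩
    rw [Set.encard_pair hij]
  exists_line := by
    intro p
    obtain ⟨q, hq⟩ : ∃ q : Fin n, q ≠ p.1 := by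
      have : Nontrivial (Fin n) := Fin.nontrivial_iff_two_le.mpr hn
      exact exists_ne p.1
    exact ⟨{p, (q, true)}, ⟨p, (q, true), fun h => hq (congrArg Prod.fst h).symm,
      fun h => hq (congrArg Prod.fst h), rfl⟩, Or.inl rfl⟩
  line_unique := by
    have key : ∀ p q i j : Fin n × Bool, p ≠ q → p ∈ ({i, j} : Set (Fin n × Bool)) →
        q ∈ ({i, j} : Set (Fin n × Bool)) → ({i, j} : Set (Fin n × Bool)) = {p, q} := by
      rintro p q i j hpq (rfl | rfl) (rfl | rfl)
      · exact absurd rfl hpq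
      · rfl
      · exact Set.pair_comm _ _
      · exact absurd rfl hpq
    rintro p q hpq L ⟨i, j, -, -, rfl⟩ M ⟨i', j', -, -, rfl⟩ h1 h2 h3 h4
    rw [key p q i j hpq h1 h2, key p q i' j' hpq h3 h4]

/-- Two partial linear spaces are isomorphic if there is a collineation between them: a bijection
of the points that maps the family of lines onto the family of lines. -/
def Isomorphic (X : PartialLinearSpace P) (Y : PartialLinearSpace Q) : Prop :=
  ∃ α : P ≃ Q, (fun L : Set P => α '' L) '' X.lines = Y.lines

/-- A thin polar space of rank `n`: a partial linear space isomorphic to the standard one. -/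
def IsThinPolarSpace (X : PartialLinearSpace P) (n : ℕ) : Prop :=
  ∃ hn : 2 ≤ n, X.Isomorphic (thinPolarSpace n hn)

/-- The polar Grassmannian of all `k`-dimensional singular subspaces. -/
abbrev Grassmannian (X : PartialLinearSpace P) (k : ℕ) : Type _ :=
  {S : X.SingularSubspace // S.HasDim (k : ℤ)}

/-- The polar Grassmann graph on the `k`-dimensional singular subspaces of a (thin) polar space of
rank `n`. For `k ≤ n - 2` two distinct vertices are adjacent if some `(k + 1)`-dimensional singular
subspace contains both; for `k = n - 1` two distinct vertices are adjacent if their intersection is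
`(n - 2)`-dimensional. -/
def grassmannGraph (X : PartialLinearSpace P) (n k : ℕ) : SimpleGraph (X.Grassmannian k) where
  Adj S T := S ≠ T ∧
    ((k + 2 ≤ n ∧ ∃ U : X.SingularSubspace, U.HasDim ((k : ℤ) + 1) ∧ S.1 ≤ U ∧ T.1 ≤ U) ∨
      (k + 1 = n ∧ (S.1.inter T.1).HasDim ((n : ℤ) - 2)))
  symm := ⟨by
    rintro S T ⟨hne, ⟨hk, U, hU, hS, hT⟩ | ⟨hk, h⟩⟩
    · exact ⟨hne.symm, Or.inl ⟨hk, U, hU, hT, hS⟩⟩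
    · refine ⟨hne.symm, Or.inr ⟨hk, ?_⟩⟩
      have : T.1.inter S.1 = S.1.inter T.1 := Subtype.ext (Set.inter_comm _ _)
      rwa [this]⟩
  loopless := ⟨fun _ h => h.1 rfl⟩

/-- A frame of a (thin) polar space of rank `n`: a set of `2n` points each of which is
non-collinear to exactly one point of the set. -/
def IsFrame (X : PartialLinearSpace P) (n : ℕ) (F : Set P) : Prop :=
  F.encard = ((2 * n : ℕ) : ℕ∞) ∧ ∀ p ∈ F, ∃! q : P, q ∈ F ∧ ¬ X.Collinear p q

/-- The apartment of the Grassmannian associated to a frame `F`: all `k`-dimensional singular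
subspaces spanned by subsets of `F`. -/
def apartment (X : PartialLinearSpace P) (k : ℕ) (F : Set P) : Set (X.Grassmannian k) :=
  {S | ∃ A ⊆ F, S.1.1 = X.span A}

/-- `𝒜` is an apartment of the Grassmannian of `k`-dimensional singular subspaces. -/
def IsApartment (X : PartialLinearSpace P) (n k : ℕ) (𝒜 : Set (X.Grassmannian k)) : Prop :=
  ∃ F : Set P, X.IsFrame n F ∧ 𝒜 = X.apartment k F

end PartialLinearSpace

/-- A graph embedding is isometric if it preserves the distance between vertices. -/
def IsIsometricEmbedding {V W : Type*} {G : SimpleGraph V} {H : SimpleGraph W} (f : G ↪g H) :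
    Prop :=
  ∀ x y : V, H.edist (f x) (f y) = G.edist x y

/-!
A vertex of `Γ_k(n)` is a face `S` with `k + 1` vertices of the cross-polytope, and two vertices at
maximal distance are antipodal faces. In `Γ_k(Π)`, two singular subspaces are at maximal distance if
and only if they are opposite: no point of one is collinear to all points of the other. An
isometric embedding is thus a family of singular subspaces `x S` for which `x S` and `x T` lie in a
common `(k + 1)`-dimensional singular subspace exactly as `S` and `T` lie in a common face, and are
opposite exactly if `S` and `T` are antipodal; for `k = n - 1` adjacency is a condition on the
intersections instead. For `k = 0` the frame is the image itself. For `k = n - 1` the `x S` with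
`a ∈ S` have exactly one common point, and these points form the frame.

Let `0 < k < n - 1` and let `W` be a face with `k + 2` vertices. The subspaces `x S` with `S ⊆ W`
are pairwise adjacent, so they are contained in a common `(k + 1)`-dimensional singular subspace (a
top) or have a common `(k - 1)`-dimensional subspace (a star). If the first alternative holds for
all `W` and `a ∈ W`, then the top of `W` has exactly one point collinear to all points of
`x (-(W \ a))`. It depends on `a` only, and these points form the frame: for `k = n - 2` the tops
are a family as in the case `k = n - 1`, and for `k < n - 2` the vertices of `W` can be exchanged
one by one.

Stars exist only if `2k + 2 ≤ n`. If not all `W` give tops, some three faces that contain a common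
face with `k` vertices and lie in a face with `k + 3` vertices are mapped into a top, and this
forces `n ≤ k + 3`. Hence `k = 1` and `n = 4`. The vertices of `Γ_1(4)` are the roots of `D₄`, and a
reflection of this root system which does not preserve the cross-polytope turns stars into tops
without changing the image of the embedding.
-/

namespace PartialLinearSpace

/-! ### Perps and spans -/

section

variable {P : Type*} {X : PartialLinearSpace P} {A B C L : Set P} {a b c p q r t u v w x : P}

theorem collinear_refl (X : PartialLinearSpace P) (p : P) : X.Collinear p p := by
  obtain ⟨L, hL, hp⟩ := X.exists_line p
  exact ⟨L, hL, hp, hp⟩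

theorem Collinear.symm (h : X.Collinear p q) : X.Collinear q p := by
  obtain ⟨L, hL, hp, hq⟩ := h
  exact ⟨L, hL, hq, hp⟩

theorem collinear_of_mem_line (hL : L ∈ X.lines) (hp : p ∈ L) (hq : q ∈ L) : X.Collinear p q :=
  ⟨L, hL, hp, hq⟩

theorem isSubspace_univ (X : PartialLinearSpace P) : X.IsSubspace Set.univ :=
  fun _ _ _ _ _ _ _ _ _ => Set.subset_univ _

theorem IsSubspace.inter (hA : X.IsSubspace A) (hB : X.IsSubspace B) : X.IsSubspace (A ∩ B) :=
  fun p hp q hq hpq L hL hpL hqL => Set.subset_inter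
    (hA p hp.1 q hq.1 hpq L hL hpL hqL) (hB p hp.2 q hq.2 hpq L hL hpL hqL)

theorem IsSubspace.mem_of_mem_line (hA : X.IsSubspace A) (hp : p ∈ A) (hq : q ∈ A) (hpq : p ≠ q)
    (hL : L ∈ X.lines) (hpL : p ∈ L) (hqL : q ∈ L) (hxL : x ∈ L) : x ∈ A :=
  hA p hp q hq hpq L hL hpL hqL hxL

/-- The set of points collinear to all points of `A`, usually written `A^⊥`. -/
def perp (X : PartialLinearSpace P) (A : Set P) : Set P := {p | ∀ a ∈ A, X.Collinear p a}

theorem mem_perp_singleton : p ∈ X.perp {q} ↔ X.Collinear p q := by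
  simp only [perp, Set.mem_singleton_iff, forall_eq, Set.mem_ofPred_eq]

theorem mem_perp_insert : p ∈ X.perp (insert q A) ↔ X.Collinear p q ∧ p ∈ X.perp A := by
  simp only [perp, Set.mem_ofPred_eq, Set.forall_mem_insert]

theorem mem_perp_pair : p ∈ X.perp {a, b} ↔ X.Collinear p a ∧ X.Collinear p b := by
  rw [mem_perp_insert, mem_perp_singleton]

theorem subset_perp_singleton : A ⊆ X.perp {p} ↔ p ∈ X.perp A :=
  ⟨fun h _ ha => (mem_perp_singleton.mp (h ha)).symm,
    fun h a ha => mem_perp_singleton.mpr (h a ha).symm⟩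

theorem perp_anti (h : A ⊆ B) : X.perp B ⊆ X.perp A := fun _ hp a ha => hp a (h ha)

theorem subset_perp_comm : A ⊆ X.perp B ↔ B ⊆ X.perp A :=
  ⟨fun h _ hb _ ha => (h ha _ hb).symm, fun h _ ha _ hb => (h hb _ ha).symm⟩

theorem subset_span (X : PartialLinearSpace P) (A : Set P) : A ⊆ X.span A :=
  Set.subset_sInter fun _ hS => hS.2

theorem span_subset (hB : X.IsSubspace B) (hAB : A ⊆ B) : X.span A ⊆ B :=
  Set.sInter_subset_of_mem ⟨hB, hAB⟩

theorem span_mono (hAB : A ⊆ B) : X.span A ⊆ X.span B :=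
  Set.subset_sInter fun _ hS => Set.sInter_subset_of_mem ⟨hS.1, hAB.trans hS.2⟩

theorem isSubspace_span (X : PartialLinearSpace P) (A : Set P) : X.IsSubspace (X.span A) :=
  fun _ hp _ hq hpq L hL hpL hqL => Set.subset_sInter fun S hS =>
    hS.1 _ (hp S hS) _ (hq S hS) hpq L hL hpL hqL

theorem IsSubspace.span_eq (hA : X.IsSubspace A) : X.span A = A :=
  (span_subset hA subset_rfl).antisymm (X.subset_span A)

theorem mem_span_insert_self (X : PartialLinearSpace P) (p : P) (A : Set P) :
    p ∈ X.span (insert p A) := X.subset_span _ (Set.mem_insert p A)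

theorem subset_span_insert (X : PartialLinearSpace P) (p : P) (A : Set P) :
    A ⊆ X.span (insert p A) := (Set.subset_insert p A).trans (X.subset_span _)

theorem span_insert_subset (hB : X.IsSubspace B) (hp : p ∈ B) (hAB : A ⊆ B) :
    X.span (insert p A) ⊆ B :=
  span_subset hB (Set.insert_subset hp hAB)

theorem span_insert_span : X.span (insert p (X.span A)) = X.span (insert p A) :=
  (span_insert_subset (X.isSubspace_span _) (X.mem_span_insert_self p A)
    (span_mono (Set.subset_insert p A))).antisymm
    (span_mono (Set.insert_subset_insert (X.subset_span A)))

theorem isSingularSubspace_empty (X : PartialLinearSpace P) : X.IsSingularSubspace ∅ :=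
  ⟨fun _ hp => hp.elim, fun _ hp => hp.elim⟩

theorem isSingularSubspace_singleton (X : PartialLinearSpace P) (p : P) :
    X.IsSingularSubspace {p} := by
  refine ⟨?_, ?_⟩
  · rintro _ rfl _ rfl hpp
    exact absurd rfl hpp
  · rintro _ rfl _ rfl
    exact X.collinear_refl _

theorem IsSingularSubspace.inter (hA : X.IsSingularSubspace A) (hB : X.IsSubspace B) :
    X.IsSingularSubspace (A ∩ B) :=
  ⟨hA.1.inter hB, fun p hp q hq => hA.2 p hp.1 q hq.1⟩

theorem IsSingularSubspace.subset_perp (hA : X.IsSingularSubspace A) : A ⊆ X.perp A :=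
  fun a ha b hb => hA.2 a ha b hb

theorem IsSingularSubspace.mem_perp (hA : X.IsSingularSubspace A) (hp : p ∈ A) (hBA : B ⊆ A) :
    p ∈ X.perp B := perp_anti hBA (hA.subset_perp hp)

/-- Shult spaces: partial linear spaces with the one-or-all axiom of polar spaces. -/
structure IsShultSpace (X : PartialLinearSpace P) : Prop where
  one_or_all : ∀ p : P, ∀ L ∈ X.lines,
    (∃! q : P, q ∈ L ∧ X.Collinear p q) ∨ (∀ q ∈ L, X.Collinear p q)

/-- The subspace `C` has trivial radical: every point of `C` is non-collinear to some point
of `C`. -/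
def NondegenerateOn (X : PartialLinearSpace P) (C : Set P) : Prop :=
  ∀ w ∈ C, ∃ r ∈ C, ¬ X.Collinear r w

/-- The union of the lines through `p` that meet `A`, together with `p`: a description of the
subspace spanned by `p` and a singular subspace `A ⊆ p^⊥` not containing `p`. -/
def cone (X : PartialLinearSpace P) (p : P) (A : Set P) : Set P :=
  {x | x = p ∨ ∃ a ∈ A, ∃ L ∈ X.lines, p ∈ L ∧ a ∈ L ∧ x ∈ L}

theorem cone_subset_span_insert (hpA : p ∉ A) : X.cone p A ⊆ X.span (insert p A) := by
  rintro x (rfl | ⟨a, ha, L, hL, hpL, haL, hxL⟩)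
  · exact X.mem_span_insert_self x A
  · exact (X.isSubspace_span _).mem_of_mem_line (X.mem_span_insert_self p A)
      (X.subset_span_insert p A ha) (ne_of_mem_of_not_mem ha hpA).symm hL hpL haL hxL

theorem mem_cone_of_mem_line (hy : b ∈ X.cone p A) (hbp : b ≠ p) (hL : L ∈ X.lines) (hp : p ∈ L)
    (hb : b ∈ L) (hx : x ∈ L) : x ∈ X.cone p A := by
  obtain hb' | ⟨a, ha, M, hM, hpM, haM, hbM⟩ := hy
  · exact absurd hb' hbp
  · obtain rfl := X.line_unique b p hbp L hL M hM hb hp hbM hpM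
    exact Or.inr ⟨a, ha, L, hL, hpM, haM, hx⟩

namespace IsShultSpace

variable (h : X.IsShultSpace)
include h

theorem exists_collinear_mem_line (hL : L ∈ X.lines) (p : P) : ∃ u ∈ L, X.Collinear p u := by
  rcases h.one_or_all p L hL with ⟨q, hq, -⟩ | hall
  · exact ⟨q, hq.1, hq.2⟩
  · obtain ⟨a, ha⟩ : L.Nonempty := Set.encard_pos.mp (zero_lt_two.trans_le (X.two_le L hL))
    exact ⟨a, ha, hall a ha⟩

theorem collinear_of_two (hL : L ∈ X.lines) (ha : a ∈ L) (hb : b ∈ L) (hab : a ≠ b)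
    (hpa : X.Collinear p a) (hpb : X.Collinear p b) (hc : c ∈ L) : X.Collinear p c := by
  rcases h.one_or_all p L hL with ⟨q, -, hq⟩ | hall
  · exact absurd ((hq a ⟨ha, hpa⟩).trans (hq b ⟨hb, hpb⟩).symm) hab
  · exact hall c hc

theorem isSubspace_perp (A : Set P) : X.IsSubspace (X.perp A) :=
  fun _ hp _ hq hpq _ hL hpL hqL _ hr a ha =>
    (h.collinear_of_two hL hpL hqL hpq (hp a ha).symm (hq a ha).symm hr).symm

theorem span_subset_perp (hAB : A ⊆ X.perp B) : X.span A ⊆ X.perp B :=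
  span_subset (h.isSubspace_perp B) hAB

theorem perp_span (A : Set P) : X.perp (X.span A) = X.perp A :=
  (perp_anti (X.subset_span A)).antisymm
    (subset_perp_comm.mp (h.span_subset_perp (subset_perp_comm.mp subset_rfl)))

theorem isSingularSubspace_span (hA : A ⊆ X.perp A) : X.IsSingularSubspace (X.span A) :=
  ⟨X.isSubspace_span A, fun p hp => by
    rw [← h.perp_span A] at hA
    exact h.span_subset_perp hA hp⟩

theorem isSingularSubspace_span_insert (hA : X.IsSingularSubspace A) (hp : p ∈ X.perp A) :
    X.IsSingularSubspace (X.span (insert p A)) :=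
  h.isSingularSubspace_span <| Set.insert_subset
    (mem_perp_insert.mpr ⟨X.collinear_refl p, hp⟩)
    fun a ha => mem_perp_insert.mpr ⟨(hp a ha).symm, hA.subset_perp ha⟩

theorem inter_perp_subset_symm (hC : X.IsSubspace C) (hN : X.NondegenerateOn C) (hu : u ∈ C)
    (ht : t ∈ C) (hut : C ∩ X.perp {u} ⊆ X.perp {t}) : C ∩ X.perp {t} ⊆ X.perp {u} := by
  simp only [Set.subset_def, Set.mem_inter_iff, mem_perp_singleton, and_imp] at hut ⊢
  intro r hr hrt
  by_contra hru
  obtain ⟨q, hq, hqt⟩ := hN t ht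
  have htu : X.Collinear t u := (hut u hu (X.collinear_refl u)).symm
  -- A point of `C` on a line `L ⊆ C` through `q` is collinear to `t` if it is collinear to `u`,
  -- so `L` has only one point collinear to `t`, and it is collinear to `u`.
  have collinear_u_of_line : ∀ y ∈ C, X.Collinear y t → X.Collinear q y → X.Collinear y u := by
    rintro y hy hyt ⟨L, hL, hqL, hyL⟩
    obtain ⟨x, hx, hux⟩ := h.exists_collinear_mem_line hL u
    have hqy : q ≠ y := by rintro rfl; exact hqt hyt
    have hxt := hut x (hC.mem_of_mem_line hq hy hqy hL hqL hyL hx) hux.symm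
    by_contra hyu
    have hxy : x ≠ y := by rintro rfl; exact hyu hux.symm
    exact hqt (h.collinear_of_two hL hx hyL hxy hxt.symm hyt.symm hqL).symm
  obtain ⟨L, hL, hrL, htL⟩ := hrt
  obtain ⟨s, hs, hqs⟩ := h.exists_collinear_mem_line hL q
  have hrt' : r ≠ t := by rintro rfl; exact hru htu
  have hst : s ≠ t := by rintro rfl; exact hqt hqs
  have hsu := collinear_u_of_line s (hC.mem_of_mem_line hr ht hrt' hL hrL htL hs)
    (collinear_of_mem_line hL hs htL) hqs
  exact hru (h.collinear_of_two hL hs htL hst hsu.symm htu.symm hrL).symm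

theorem exists_collinear_not_collinear (hC : X.IsSubspace C) (hN : X.NondegenerateOn C)
    (hu : u ∈ C) (hw : w ∈ C) (huw : u ≠ w) : ∃ q ∈ C, X.Collinear q u ∧ ¬ X.Collinear q w := by
  by_contra! hcon
  obtain ⟨r, hr, hrw⟩ := hN w hw
  have hru : ¬ X.Collinear r u := fun hru => hrw (hcon r hr hru)
  obtain ⟨L, hL, huL, hwL⟩ := hcon u hu (X.collinear_refl u)
  obtain ⟨t, htL, hrt⟩ := h.exists_collinear_mem_line hL r
  have ht : t ∈ C := hC.mem_of_mem_line hu hw huw hL huL hwL htL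
  have hut : C ∩ X.perp {u} ⊆ X.perp {t} := fun q ⟨hq, hqu⟩ => by
    rw [mem_perp_singleton] at hqu ⊢
    exact h.collinear_of_two hL huL hwL huw hqu (hcon q hq hqu) htL
  exact hru (mem_perp_singleton.mp
    (h.inter_perp_subset_symm hC hN hu ht hut ⟨hr, mem_perp_singleton.mpr hrt⟩))

theorem nondegenerateOn_inter_perp_pair (hC : X.IsSubspace C) (hN : X.NondegenerateOn C)
    (ha : a ∈ C) (haq : ¬ X.Collinear a q) : X.NondegenerateOn (C ∩ X.perp {a, q}) := by
  rintro w ⟨hwC, hw⟩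
  obtain ⟨hwa, hwq⟩ := mem_perp_pair.mp hw
  have haw : a ≠ w := by rintro rfl; exact haq hwq
  obtain ⟨y, hy, hya, hyw⟩ := h.exists_collinear_not_collinear hC hN ha hwC haw
  have hya' : y ≠ a := by rintro rfl; exact hyw hwa.symm
  obtain ⟨L, hL, hyL, haL⟩ := hya
  obtain ⟨s, hs, hqs⟩ := h.exists_collinear_mem_line hL q
  have hsa : s ≠ a := by rintro rfl; exact haq hqs.symm
  exact ⟨s, ⟨hC.mem_of_mem_line hy ha hya' hL hyL haL hs,
    mem_perp_pair.mpr ⟨collinear_of_mem_line hL hs haL, hqs.symm⟩⟩, fun hsw => hyw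
    (h.collinear_of_two hL hs haL hsa hsw.symm hwa hyL).symm⟩

theorem exists_mem_perp_pair_not_collinear (hC : X.IsSubspace C) (hN : X.NondegenerateOn C)
    (hv : v ∈ C) (hvr : ¬ X.Collinear v r) (hu : u ∈ C ∩ X.perp {v, r})
    (hw : w ∈ C ∩ X.perp {v, r}) (huw : u ≠ w) :
    ∃ q ∈ C ∩ X.perp {v, r}, X.Collinear q u ∧ ¬ X.Collinear q w :=
  h.exists_collinear_not_collinear (hC.inter (h.isSubspace_perp _))
    (h.nondegenerateOn_inter_perp_pair hC hN hv hvr) hu hw huw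

theorem exists_mem_perp_line_not_collinear (hC : X.IsSubspace C) (hN : X.NondegenerateOn C)
    (hL : L ∈ X.lines) (hLC : L ⊆ C) (hp : p ∉ L) (hpC : p ∈ C) :
    ∃ q ∈ C, q ∈ X.perp L ∧ ¬ X.Collinear q p := by
  by_cases hall : ∀ v ∈ L, X.Collinear v p
  swap
  · push Not at hall
    obtain ⟨v, hv, hvp⟩ := hall
    exact ⟨v, hLC hv, fun x hx => collinear_of_mem_line hL hv hx, hvp⟩
  obtain ⟨r, hr, hrp⟩ := hN p hpC
  by_cases hrL : ∀ x ∈ L, X.Collinear r x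
  · exact ⟨r, hr, hrL, hrp⟩
  push Not at hrL
  obtain ⟨v, hv, hrv⟩ := hrL
  have hvp : v ≠ p := ne_of_mem_of_not_mem hv hp
  obtain ⟨M, hM, hvM, hpM⟩ := hall v hv
  obtain ⟨u, hu, hru⟩ := h.exists_collinear_mem_line hL r
  obtain ⟨w, hw, hrw⟩ := h.exists_collinear_mem_line hM r
  have huv : u ≠ v := by rintro rfl; exact hrv hru
  have huw : u ≠ w := by
    rintro rfl
    exact hp (X.line_unique u v huv L hL M hM hu hv hw hvM ▸ hpM)
  obtain ⟨q, ⟨hq, hqvr⟩, hqu, hqw⟩ := h.exists_mem_perp_pair_not_collinear hC hN (hLC hv)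
    (fun hvr => hrv hvr.symm)
    ⟨hLC hu, mem_perp_pair.mpr ⟨collinear_of_mem_line hL hu hv, hru.symm⟩⟩
    ⟨hC.mem_of_mem_line (hLC hv) hpC hvp hM hvM hpM hw,
      mem_perp_pair.mpr ⟨collinear_of_mem_line hM hw hvM, hrw.symm⟩⟩ huw
  have hqv : X.Collinear q v := (mem_perp_pair.mp hqvr).1
  exact ⟨q, hq, fun x hx => h.collinear_of_two hL hu hv huv hqu hqv hx,
    fun hqp => hqw (h.collinear_of_two hM hvM hpM hvp hqv hqp hw)⟩

theorem mem_line_of_forall_collinear (hN : X.NondegenerateOn Set.univ) (hL : L ∈ X.lines)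
    (hpq : ¬ X.Collinear p q) (hLpq : L ⊆ X.perp {p, q}) (hcpq : c ∈ X.perp {p, q})
    (hc : ∀ r ∈ X.perp L, X.Collinear r p → X.Collinear r c) : c ∈ L := by
  by_contra hcL
  obtain ⟨r, ⟨-, hr⟩, hrL, hrc⟩ := h.exists_mem_perp_line_not_collinear
    (X.isSubspace_univ.inter (h.isSubspace_perp {p, q}))
    (h.nondegenerateOn_inter_perp_pair X.isSubspace_univ hN trivial hpq)
    hL (fun x hx => ⟨trivial, hLpq hx⟩) hcL ⟨trivial, hcpq⟩
  exact hrc (hc r hrL (mem_perp_pair.mp hr).1)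

/-- The Veblen–Young axiom for the singular subspace spanned by `p` and the line `K`: the lines
`R` through `p` and `K` of this plane meet. -/
theorem exists_mem_inter_of_perp_subset (hN : X.NondegenerateOn Set.univ) {K R : Set P}
    (hK : K ∈ X.lines) (hR : R ∈ X.lines) (hpK : p ∈ X.perp K) (hpK' : p ∉ K) (hpR : p ∈ R)
    (hxR : x ∈ R) (hxp : x ≠ p) (hx : X.perp (insert p K) ⊆ X.perp {x}) : ∃ c ∈ K, c ∈ R := by
  obtain ⟨q, -, hqK, hqp⟩ := h.exists_mem_perp_line_not_collinear X.isSubspace_univ hN hK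
    (Set.subset_univ K) hpK' trivial
  obtain ⟨c, hcR, hqc⟩ := h.exists_collinear_mem_line hR q
  refine ⟨c, h.mem_line_of_forall_collinear hN hK (fun hpq => hqp hpq.symm)
    (fun y hy => mem_perp_pair.mpr ⟨(hpK y hy).symm, (hqK y hy).symm⟩)
    (mem_perp_pair.mpr ⟨collinear_of_mem_line hR hcR hpR, hqc.symm⟩) fun r hrK hrp => ?_, hcR⟩
  have hrx := mem_perp_singleton.mp (hx (mem_perp_insert.mpr ⟨hrp, hrK⟩))
  exact h.collinear_of_two hR hpR hxR hxp.symm hrp hrx hcR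

theorem isSubspace_cone (hN : X.NondegenerateOn Set.univ) (hA : X.IsSingularSubspace A)
    (hp : p ∈ X.perp A) (hpA : p ∉ A) : X.IsSubspace (X.cone p A) := by
  intro x hx y hy hxy L hL hxL hyL z hz
  by_cases hzp : z = p
  · exact Or.inl hzp
  by_cases hpL : p ∈ L
  · by_cases hxp : x = p
    · exact mem_cone_of_mem_line hy (hxp ▸ hxy.symm) hL hpL hyL hz
    · exact mem_cone_of_mem_line hx hxp hL hpL hxL hz
  obtain rfl | ⟨a, ha, M, hM, hpM, haM, hxM⟩ := hx
  · exact absurd hxL hpL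
  obtain rfl | ⟨b, hb, N, hN', hpN, hbN, hyN⟩ := hy
  · exact absurd hyL hpL
  have hpa : p ≠ a := (ne_of_mem_of_not_mem ha hpA).symm
  have hpb : p ≠ b := (ne_of_mem_of_not_mem hb hpA).symm
  have hab : a ≠ b := by
    rintro rfl
    obtain rfl := X.line_unique p a hpa M hM N hN' hpM haM hpN hbN
    exact hpL (X.line_unique x y hxy L hL M hM hxL hyL hxM hyN ▸ hpM)
  obtain ⟨K, hK, haK, hbK⟩ := hA.2 a ha b hb
  have hKA : K ⊆ A := hA.1 a ha b hb hab K hK haK hbK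
  have hpz : X.perp (insert p K) ⊆ X.perp {z} := by
    intro r hr
    obtain ⟨hrp, hrK⟩ := mem_perp_insert.mp hr
    exact mem_perp_singleton.mpr (h.collinear_of_two hL hxL hyL hxy
      (h.collinear_of_two hM hpM haM hpa hrp (hrK a haK) hxM)
      (h.collinear_of_two hN' hpN hbN hpb hrp (hrK b hbK) hyN) hz)
  have hpK : p ∈ X.perp K := perp_anti hKA hp
  obtain ⟨R, hR, hpR, hzR⟩ := mem_perp_singleton.mp
    (hpz (mem_perp_insert.mpr ⟨X.collinear_refl p, hpK⟩))
  obtain ⟨c, hcK, hcR⟩ := h.exists_mem_inter_of_perp_subset hN hK hR hpK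
    (fun hpK => hpA (hKA hpK)) hpR hzR hzp hpz
  exact Or.inr ⟨c, hKA hcK, R, hR, hpR, hcR, hzR⟩

theorem span_insert_eq_cone (hN : X.NondegenerateOn Set.univ) (hA : X.IsSingularSubspace A)
    (hp : p ∈ X.perp A) (hpA : p ∉ A) : X.span (insert p A) = X.cone p A := by
  refine (span_insert_subset (h.isSubspace_cone hN hA hp hpA) (Or.inl rfl) fun a ha => ?_).antisymm
    (cone_subset_span_insert hpA)
  obtain ⟨L, hL, hpL, haL⟩ := hp a ha
  exact Or.inr ⟨a, ha, L, hL, hpL, haL, haL⟩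

theorem mem_span_insert_of_mem_span_insert (hN : X.NondegenerateOn Set.univ)
    (hA : X.IsSingularSubspace A) (hp : p ∈ X.perp A) (hx : x ∈ X.span (insert p A))
    (hxA : x ∉ A) : p ∈ X.span (insert x A) := by
  by_cases hpA : p ∈ A
  · exact X.subset_span_insert x A hpA
  rw [h.span_insert_eq_cone hN hA hp hpA] at hx
  obtain rfl | ⟨a, ha, L, hL, hpL, haL, hxL⟩ := hx
  · exact X.mem_span_insert_self x A
  · exact (X.isSubspace_span _).mem_of_mem_line (X.mem_span_insert_self x A)
      (X.subset_span_insert x A ha) (ne_of_mem_of_not_mem ha hxA).symm hL hxL haL hpL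

theorem eq_span_insert_inter (hN : X.NondegenerateOn Set.univ) (hA : X.IsSingularSubspace A)
    (hC : X.IsSubspace C) (hx : x ∈ X.perp A) (hxA : x ∉ A) (hxC : x ∈ C)
    (hCA : C ⊆ X.span (insert x A)) : C = X.span (insert x (A ∩ C)) := by
  refine subset_antisymm (fun y hy => ?_) (span_insert_subset hC hxC Set.inter_subset_right)
  rw [h.span_insert_eq_cone hN hA hx hxA] at hCA
  refine cone_subset_span_insert (fun hxAC => hxA hxAC.1) ?_
  by_cases hyx : y = x
  · exact Or.inl hyx
  · obtain rfl | ⟨a, ha, L, hL, hxL, haL, hyL⟩ := hCA hy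
    · exact absurd rfl hyx
    · exact Or.inr ⟨a, ⟨ha, hC.mem_of_mem_line hy hxC hyx hL hyL hxL haL⟩, L, hL, hxL, haL, hyL⟩

end IsShultSpace

end

/-! ### Rank of singular subspaces -/

section

variable {P : Type*} {X : PartialLinearSpace P} {A B C : Set P} {p q x : P} {m n : ℕ}

open Classical in
/-- The rank of a singular subspace: its projective dimension plus one. It is `0` on sets that are
not singular subspaces. -/
noncomputable def rk (X : PartialLinearSpace P) (A : Set P) : ℕ :=
  if hA : X.IsSingularSubspace A then
    (Order.height (⟨A, hA⟩ : X.SingularSubspace)).toNat else 0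

/-- The axioms of a polar space of rank `n`, except that lines may have only two points. They cover
both polar spaces and thin polar spaces. -/
structure IsWeakPolarSpace (X : PartialLinearSpace P) (n : ℕ) : Prop extends X.IsShultSpace where
  nondegenerate : ¬ ∃ p : P, ∀ q : P, X.Collinear p q
  finite_chain : ∀ C : Set X.SingularSubspace, IsChain (· ≤ ·) C → C.Finite
  hasRank : X.HasRank n

theorem IsPolarSpace.isWeakPolarSpace (hX : X.IsPolarSpace) (hn : X.HasRank n) :
    X.IsWeakPolarSpace n where
  one_or_all := hX.one_or_all
  nondegenerate := hX.nondegenerate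
  finite_chain := hX.finite_chain
  hasRank := hn

namespace IsWeakPolarSpace

variable (h : X.IsWeakPolarSpace n)
include h

theorem nondegenerateOn_univ : X.NondegenerateOn Set.univ := by
  intro w _
  by_contra! hw
  exact h.nondegenerate ⟨w, fun q => (hw q trivial).symm⟩

theorem exists_le_isMax (S : X.SingularSubspace) : ∃ M, S ≤ M ∧ IsMax M := by
  refine zorn_le_nonempty_Ici₀ S (fun c _ hc y hy => ?_) S le_rfl
  obtain ⟨m, hm, hmax⟩ := (h.finite_chain c hc).exists_maximal ⟨y, hy⟩
  exact ⟨m, fun z hz => (hc.total hm hz).elim (hmax hz) id⟩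

theorem height_of_isMax {M : X.SingularSubspace} (hM : IsMax M) : Order.height M = n := by
  obtain ⟨m, hm, hmn⟩ := h.hasRank M hM
  rw [hm, show m = n by lia]

theorem height_le (S : X.SingularSubspace) : Order.height S ≤ n := by
  obtain ⟨M, hSM, hM⟩ := h.exists_le_isMax S
  exact (Order.height_mono hSM).trans (h.height_of_isMax hM).le

theorem height_ne_top (S : X.SingularSubspace) : Order.height S ≠ ⊤ :=
  ne_top_of_le_ne_top (ENat.natCast_ne_top n) (h.height_le S)

theorem coe_rk (hA : X.IsSingularSubspace A) :
    (X.rk A : ℕ∞) = Order.height (⟨A, hA⟩ : X.SingularSubspace) := by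
  rw [rk, dif_pos hA]
  exact ENat.natCast_toNat (h.height_ne_top _)

theorem rk_le (hA : X.IsSingularSubspace A) : X.rk A ≤ n := by
  have := h.height_le ⟨A, hA⟩
  rw [← h.coe_rk hA] at this
  exact_mod_cast this

theorem exists_mem_perp_notMem (hA : X.IsSingularSubspace A) (hAn : X.rk A < n) :
    ∃ p ∈ X.perp A, p ∉ A := by
  have hmax : ¬ IsMax (⟨A, hA⟩ : X.SingularSubspace) := fun hmax => by
    have := h.coe_rk hA
    rw [h.height_of_isMax hmax] at this
    exact hAn.ne (by exact_mod_cast this)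
  obtain ⟨B, hAB⟩ := not_isMax_iff.mp hmax
  obtain ⟨p, hpB, hpA⟩ := Set.not_subset.mp (show ¬ B.1 ⊆ A from hAB.not_ge)
  exact ⟨p, B.2.mem_perp hpB hAB.le, hpA⟩

theorem hasDim_iff (S : X.SingularSubspace) (d : ℤ) : S.HasDim d ↔ (X.rk S.1 : ℤ) = d + 1 := by
  have hS := h.coe_rk S.2
  refine ⟨?_, fun hd => ⟨X.rk S.1, hS.symm, hd⟩⟩
  rintro ⟨m, hm, hd⟩
  rw [hm] at hS
  rw [← hd]
  exact_mod_cast hS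

theorem rk_lt (hA : X.IsSingularSubspace A) (hB : X.IsSingularSubspace B) (hAB : A ⊂ B) :
    X.rk A < X.rk B := by
  have hlt : (⟨A, hA⟩ : X.SingularSubspace) < ⟨B, hB⟩ := hAB
  have := Order.height_strictMono hlt (lt_top_iff_ne_top.mpr (h.height_ne_top _))
  rw [← h.coe_rk hA, ← h.coe_rk hB] at this
  exact_mod_cast this

theorem rk_mono (hA : X.IsSingularSubspace A) (hB : X.IsSingularSubspace B) (hAB : A ⊆ B) :
    X.rk A ≤ X.rk B := by
  rcases hAB.eq_or_ssubset with rfl | hlt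
  · exact le_rfl
  · exact (h.rk_lt hA hB hlt).le

theorem eq_of_subset (hA : X.IsSingularSubspace A) (hB : X.IsSingularSubspace B) (hAB : A ⊆ B)
    (hr : X.rk B ≤ X.rk A) : A = B :=
  hAB.eq_or_ssubset.resolve_right fun hlt => hr.not_gt (h.rk_lt hA hB hlt)

theorem exists_mem_notMem (hA : X.IsSingularSubspace A) (hB : X.IsSingularSubspace B)
    (hr : X.rk A < X.rk B) : ∃ x ∈ B, x ∉ A := by
  by_contra! hBA
  exact hr.not_ge (h.rk_mono hB hA hBA)

theorem rk_lt_rk_span_insert (hA : X.IsSingularSubspace A) (hp : p ∈ X.perp A) (hpA : p ∉ A) :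
    X.rk A < X.rk (X.span (insert p A)) :=
  h.rk_lt hA (h.isSingularSubspace_span_insert hA hp)
    ⟨X.subset_span_insert p A, fun hle => hpA (hle (X.mem_span_insert_self p A))⟩

theorem rk_span_insert_le (hA : X.IsSingularSubspace A) (hp : p ∈ X.perp A) (hpA : p ∉ A) :
    X.rk (X.span (insert p A)) ≤ X.rk A + 1 := by
  induction hr : X.rk A using Nat.strong_induction_on generalizing A p with
  | _ m ih =>
    subst hr
    have hB := h.isSingularSubspace_span_insert hA hp
    suffices Order.height (⟨_, hB⟩ : X.SingularSubspace) ≤ ((X.rk A + 1 : ℕ) : ℕ∞) by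
      rw [← h.coe_rk hB] at this
      exact_mod_cast this
    rw [Order.height_le_coe_iff]
    rintro ⟨C, hC⟩ hlt
    have hCB : C ⊆ X.span (insert p A) := hlt.le
    rw [← h.coe_rk hC, Nat.cast_lt]
    by_cases hCA : C ⊆ A
    · exact Nat.lt_succ_of_le (h.rk_mono hC hA hCA)
    obtain ⟨x, hxC, hxA⟩ := Set.not_subset.mp hCA
    have hpx := h.mem_span_insert_of_mem_span_insert h.nondegenerateOn_univ hA hp (hCB hxC) hxA
    have hx : x ∈ X.perp A := hB.mem_perp (hCB hxC) (X.subset_span_insert p A)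
    have hC' : C = X.span (insert x (A ∩ C)) :=
      h.eq_span_insert_inter h.nondegenerateOn_univ hA hC.1 hx hxA hxC
        (hCB.trans (span_insert_subset (X.isSubspace_span _) hpx (X.subset_span_insert x A)))
    have hAC : A ∩ C ⊂ A := by
      refine Set.inter_subset_left.ssubset_of_ne fun hAC => hlt.not_ge ?_
      rw [Set.inter_eq_left] at hAC
      exact span_insert_subset hC.1 (span_insert_subset hC.1 hxC hAC hpx) hAC
    have hI := hA.inter hC.1
    have hlt' := h.rk_lt hI hA hAC
    have hle := ih _ hlt' hI (perp_anti Set.inter_subset_left hx) (fun hxI => hxA hxI.1) rfl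
    rw [← hC'] at hle
    lia

theorem rk_span_insert (hA : X.IsSingularSubspace A) (hp : p ∈ X.perp A) (hpA : p ∉ A) :
    X.rk (X.span (insert p A)) = X.rk A + 1 :=
  (h.rk_span_insert_le hA hp hpA).antisymm (h.rk_lt_rk_span_insert hA hp hpA)

theorem eq_span_insert (hA : X.IsSingularSubspace A) (hB : X.IsSingularSubspace B) (hAB : A ⊆ B)
    (hr : X.rk B ≤ X.rk A + 1) (hxB : x ∈ B) (hxA : x ∉ A) : B = X.span (insert x A) := by
  have hx : x ∈ X.perp A := hB.mem_perp hxB hAB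
  refine (h.eq_of_subset (h.isSingularSubspace_span_insert hA hx) hB
    (span_insert_subset hB.1 hxB hAB) ?_).symm
  rwa [h.rk_span_insert hA hx hxA]

theorem rk_le_rk_inter (hA : X.IsSingularSubspace A) (hB : X.IsSingularSubspace B)
    (hC : X.IsSingularSubspace C) (hAC : A ⊆ C) (hBC : B ⊆ C) (hr : X.rk C ≤ X.rk B + 1) :
    X.rk A ≤ X.rk (A ∩ B) + 1 := by
  by_cases hAB : A ⊆ B
  · rw [Set.inter_eq_left.mpr hAB]
    lia
  obtain ⟨x, hxA, hxB⟩ := Set.not_subset.mp hAB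
  have hCx := h.eq_span_insert hB hC hBC hr (hAC hxA) hxB
  have hAx := h.eq_span_insert_inter h.nondegenerateOn_univ hB hA.1 (hC.mem_perp (hAC hxA) hBC)
    hxB hxA (hCx ▸ hAC)
  rw [Set.inter_comm] at hAx
  have hle := h.rk_span_insert_le (hA.inter hB.1) (hA.mem_perp hxA Set.inter_subset_left)
    (fun hx => hxB hx.2)
  rwa [← hAx] at hle

theorem rk_le_rk_inter_perp (hA : X.IsSingularSubspace A) (p : P) :
    X.rk A ≤ X.rk (A ∩ X.perp {p}) + 1 := by
  by_cases hAp : A ⊆ X.perp {p}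
  · rw [Set.inter_eq_left.mpr hAp]
    lia
  obtain ⟨x, hxA, hxp⟩ := Set.not_subset.mp hAp
  have hI : X.IsSingularSubspace (A ∩ X.perp {p}) := hA.inter (h.isSubspace_perp _)
  have hx : x ∈ X.perp (A ∩ X.perp {p}) := hA.mem_perp hxA Set.inter_subset_left
  have hxI : x ∉ A ∩ X.perp {p} := fun hx => hxp hx.2
  have hsub : A ⊆ X.cone x (A ∩ X.perp {p}) := by
    intro y hy
    by_cases hyx : y = x
    · exact Or.inl hyx
    obtain ⟨L, hL, hxL, hyL⟩ := hA.2 x hxA y hy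
    obtain ⟨u, hu, hpu⟩ := h.exists_collinear_mem_line hL p
    exact Or.inr ⟨u, ⟨hA.1.mem_of_mem_line hy hxA hyx hL hyL hxL hu,
      mem_perp_singleton.mpr hpu.symm⟩, L, hL, hxL, hu, hyL⟩
  exact (h.rk_mono hA (h.isSingularSubspace_span_insert hI hx)
    (hsub.trans (cone_subset_span_insert hxI))).trans (h.rk_span_insert_le hI hx hxI)

theorem rk_empty : X.rk ∅ = 0 := by
  have : (X.rk ∅ : ℕ∞) = 0 := by
    rw [h.coe_rk X.isSingularSubspace_empty, Order.height_eq_zero]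
    exact fun B _ => Set.empty_subset B.1
  exact_mod_cast this

theorem nonempty_of_rk_pos (hr : 0 < X.rk A) : A.Nonempty := by
  by_contra hA
  rw [Set.not_nonempty_iff_eq_empty.mp hA, h.rk_empty] at hr
  exact lt_irrefl _ hr

theorem eq_empty_of_rk_eq_zero (hA : X.IsSingularSubspace A) (hr : X.rk A = 0) : A = ∅ :=
  (h.eq_of_subset X.isSingularSubspace_empty hA (Set.empty_subset _) (by lia)).symm

theorem rk_pos (hA : X.IsSingularSubspace A) (hne : A.Nonempty) : 0 < X.rk A :=
  Nat.pos_of_ne_zero fun hr => hne.ne_empty (h.eq_empty_of_rk_eq_zero hA hr)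

theorem rk_singleton (p : P) : X.rk {p} = 1 := by
  have := h.rk_span_insert X.isSingularSubspace_empty (p := p) (fun _ => False.elim) id
  rwa [LawfulSingleton.insert_empty_eq, (X.isSingularSubspace_singleton p).1.span_eq,
    h.rk_empty] at this

theorem eq_of_mem_of_rk_le_one (hA : X.IsSingularSubspace A) (hr : X.rk A ≤ 1) (hp : p ∈ A)
    (hq : q ∈ A) : p = q := by
  have hpA := h.eq_of_subset (X.isSingularSubspace_singleton p) hA
    (Set.singleton_subset_iff.mpr hp) (by rwa [h.rk_singleton])
  rw [← hpA] at hq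
  exact hq.symm

theorem exists_between (hA : X.IsSingularSubspace A) (hB : X.IsSingularSubspace B) (hAB : A ⊆ B)
    (hAm : X.rk A ≤ m) (hmB : m ≤ X.rk B) :
    ∃ C, X.IsSingularSubspace C ∧ A ⊆ C ∧ C ⊆ B ∧ X.rk C = m := by
  induction m, hAm using Nat.le_induction with
  | base => exact ⟨A, hA, subset_rfl, hAB, rfl⟩
  | succ m _ ih =>
    obtain ⟨C, hC, hAC, hCB, hr⟩ := ih (by lia)
    obtain ⟨x, hxB, hxC⟩ := h.exists_mem_notMem hC hB (by lia)
    have hx : x ∈ X.perp C := hB.mem_perp hxB hCB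
    exact ⟨X.span (insert x C), h.isSingularSubspace_span_insert hC hx,
      hAC.trans (X.subset_span_insert x C), span_insert_subset hB.1 hxB hCB,
      by rw [h.rk_span_insert hC hx hxC, hr]⟩

theorem rk_inter_perp_add_le (hA : X.IsSingularSubspace A) (hB : X.IsSingularSubspace B)
    (hC : X.IsSingularSubspace C) (hBC : B ⊆ C) :
    X.rk (A ∩ X.perp B) + X.rk B ≤ X.rk (A ∩ X.perp C) + X.rk C := by
  induction _ : X.rk C - X.rk B generalizing B with
  | zero => rw [h.eq_of_subset hB hC hBC (by lia)]
  | succ m ih =>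
    obtain ⟨x, hxC, hxB⟩ := h.exists_mem_notMem hB hC (by lia)
    have hx : x ∈ X.perp B := hC.mem_perp hxC hBC
    have hrk := h.rk_span_insert hB hx hxB
    have hle := ih (h.isSingularSubspace_span_insert hB hx) (span_insert_subset hC.1 hxC hBC)
      (by lia)
    have hstep := h.rk_le_rk_inter_perp (hA.inter (h.isSubspace_perp B)) x
    have hperp : A ∩ X.perp B ∩ X.perp {x} = A ∩ X.perp (X.span (insert x B)) := by
      ext y
      rw [h.perp_span, Set.mem_inter_iff, Set.mem_inter_iff, Set.mem_inter_iff, mem_perp_insert,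
        mem_perp_singleton]
      tauto
    rw [hperp] at hstep
    lia

theorem exists_mem_inter_perp (hA : X.IsSingularSubspace A) (hB : X.IsSingularSubspace B)
    (hr : X.rk B < X.rk A) : (A ∩ X.perp B).Nonempty := by
  have hle := h.rk_inter_perp_add_le hA X.isSingularSubspace_empty hB (Set.empty_subset _)
  have hperp : A ∩ X.perp ∅ = A := Set.inter_eq_left.mpr fun _ _ _ => False.elim
  rw [hperp, h.rk_empty] at hle
  exact h.nonempty_of_rk_pos (by lia)

theorem mem_of_mem_perp (hA : X.IsSingularSubspace A) (hr : X.rk A = n) (hp : p ∈ X.perp A) :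
    p ∈ A := by
  by_contra hpA
  have hrk := h.rk_span_insert hA hp hpA
  have hle := h.rk_le (h.isSingularSubspace_span_insert hA hp)
  lia

theorem rk_span_union_image {ι : Type*} [DecidableEq ι] {s : Finset ι} {y : ι → P}
    (hA : X.IsSingularSubspace A) (hcol : A ∪ y '' s ⊆ X.perp (A ∪ y '' s))
    (hy : ∀ a ∈ s, y a ∉ X.span (A ∪ y '' (s.erase a : Finset ι))) :
    X.rk (X.span (A ∪ y '' s)) = X.rk A + s.card := by
  induction s using Finset.induction_on with
  | empty => rw [Finset.coe_empty, Set.image_empty, Set.union_empty, hA.1.span_eq,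
      Finset.card_empty, add_zero]
  | insert a s ha ih =>
    have hsub {t t' : Finset ι} (ht : t ⊆ t') : A ∪ y '' t ⊆ A ∪ y '' t' :=
      Set.union_subset_union_right _ (Set.image_mono (Finset.coe_subset.mpr ht))
    have hs := hsub (Finset.subset_insert a s)
    have hcol' := hs.trans (hcol.trans (perp_anti hs))
    have hya : y a ∈ X.perp (X.span (A ∪ y '' s)) := by
      rw [h.perp_span]
      exact perp_anti hs (hcol (Or.inr ⟨a, Finset.mem_insert_self a s, rfl⟩))
    have hya' := hy a (Finset.mem_insert_self a s)
    rw [Finset.erase_insert ha] at hya'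
    rw [Finset.coe_insert, Set.image_insert_eq, Set.union_insert, ← span_insert_span,
      h.rk_span_insert (h.isSingularSubspace_span hcol') hya hya', ih hcol' fun b hb hmem =>
        hy b (Finset.mem_insert_of_mem hb) (span_mono (hsub (Finset.erase_subset_erase b
          (Finset.subset_insert a s))) hmem), Finset.card_insert_of_notMem ha]
    rfl

theorem rk_span_image {ι : Type*} [DecidableEq ι] {s : Finset ι} {y : ι → P}
    (hcol : y '' s ⊆ X.perp (y '' s))
    (hy : ∀ a ∈ s, y a ∉ X.span (y '' (s.erase a : Finset ι))) :
    X.rk (X.span (y '' s)) = s.card := by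
  have hrk := h.rk_span_union_image (s := s) (y := y) X.isSingularSubspace_empty
  simp only [Set.empty_union, h.rk_empty, zero_add] at hrk
  exact hrk hcol hy

end IsWeakPolarSpace

end

/-! ### Opposition in Grassmann graphs -/

section

theorem exists_walk_of_edist_le {V : Type*} {G : SimpleGraph V} {u v : V} {m : ℕ}
    (hm : G.edist u v ≤ m) : ∃ w : G.Walk u v, w.length ≤ m := by
  obtain ⟨w, hw⟩ := SimpleGraph.exists_walk_of_edist_ne_top
    (ne_top_of_le_ne_top (ENat.natCast_ne_top m) hm)
  rw [← hw] at hm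
  exact ⟨w, by exact_mod_cast hm⟩

theorem edist_le_succ_of_adj {V : Type*} {G : SimpleGraph V} {u v w : V} {m : ℕ}
    (huv : G.Adj u v) (hm : G.edist v w ≤ m) : G.edist u w ≤ (m + 1 : ℕ) := by
  refine SimpleGraph.edist_triangle.trans ((add_le_add
    (SimpleGraph.edist_eq_one_iff_adj.mpr huv).le hm).trans_eq ?_)
  push_cast
  exact add_comm _ _

variable {P : Type*} {X : PartialLinearSpace P} {A B : Set P} {p q : P} {k m n : ℕ}
  {S T : X.Grassmannian k}

/-- `A` and `B` lie in a common singular subspace of rank `m`. -/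
def Joint (X : PartialLinearSpace P) (m : ℕ) (A B : Set P) : Prop :=
  ∃ U, X.IsSingularSubspace U ∧ X.rk U = m ∧ A ⊆ U ∧ B ⊆ U

/-- No point of `B` is collinear to all points of `A`; for singular subspaces of the same rank this
is the opposition relation of the building. -/
def Opposite (X : PartialLinearSpace P) (A B : Set P) : Prop := Disjoint B (X.perp A)

namespace IsWeakPolarSpace

variable (h : X.IsWeakPolarSpace n)
include h

theorem rk_grassmannian (S : X.Grassmannian k) : X.rk S.1.1 = k + 1 := by
  exact_mod_cast (h.hasDim_iff S.1 k).mp S.2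

/-- The vertex of the Grassmannian given by a singular subspace of rank `k + 1`. -/
def vertex (hA : X.IsSingularSubspace A) (hr : X.rk A = k + 1) : X.Grassmannian k :=
  ⟨⟨A, hA⟩, (h.hasDim_iff _ _).mpr (by rw [hr]; push_cast; ring)⟩

theorem subset_of_rk_le_rk_inter (hA : X.IsSingularSubspace A) (hB : X.IsSingularSubspace B)
    (hr : X.rk A ≤ X.rk (A ∩ B)) : A ⊆ B :=
  Set.inter_eq_left.mp (h.eq_of_subset (hA.inter hB.1) hA Set.inter_subset_left hr)

theorem rk_le_rk_inter_of_joint (hA : X.IsSingularSubspace A) (hB : X.IsSingularSubspace B)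
    (hr : m ≤ X.rk B + 1) (hJ : X.Joint m A B) : X.rk A ≤ X.rk (A ∩ B) + 1 := by
  obtain ⟨U, hU, rfl, hAU, hBU⟩ := hJ
  exact h.rk_le_rk_inter hA hB hU hAU hBU hr

theorem subset_or_inter_subset {C U : Set P} (hA : X.IsSingularSubspace A)
    (hB : X.IsSingularSubspace B) (hC : X.IsSingularSubspace C) (hU : X.IsSubspace U)
    (hAU : A ⊆ U) (hBU : B ⊆ U) (hAC : X.rk (A ∩ B) ≤ X.rk (A ∩ C))
    (hBC : X.rk C ≤ X.rk (B ∩ C) + 1) : C ⊆ U ∨ A ∩ B ⊆ C := by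
  by_cases hsub : A ∩ C ⊆ B
  · have heq := h.eq_of_subset (hA.inter hC.1) (hA.inter hB.1)
      (Set.subset_inter Set.inter_subset_left hsub) hAC
    exact Or.inr (heq ▸ Set.inter_subset_right)
  · obtain ⟨q, ⟨hqA, hqC⟩, hqB⟩ := Set.not_subset.mp hsub
    rw [h.eq_span_insert (hB.inter hC.1) hC Set.inter_subset_right hBC hqC fun hq => hqB hq.1]
    exact Or.inl (span_insert_subset hU (hAU hqA) (Set.inter_subset_left.trans hBU))

theorem grassmannian_eq_of_subset (hST : S.1.1 ⊆ T.1.1) : S = T :=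
  Subtype.ext (Subtype.ext (h.eq_of_subset S.1.2 T.1.2 hST
    (by rw [h.rk_grassmannian, h.rk_grassmannian])))

theorem grassmannian_eq_of_rk_inter (hr : k + 1 ≤ X.rk (S.1.1 ∩ T.1.1)) : S = T :=
  h.grassmannian_eq_of_subset (h.subset_of_rk_le_rk_inter S.1.2 T.1.2
    (by rwa [h.rk_grassmannian]))

theorem adj_iff_joint (hk : k + 2 ≤ n) (S T : X.Grassmannian k) :
    (X.grassmannGraph n k).Adj S T ↔ S ≠ T ∧ X.Joint (k + 2) S.1.1 T.1.1 := by
  have hasDim_iff_rk (U : X.SingularSubspace) : U.HasDim ((k : ℤ) + 1) ↔ X.rk U.1 = k + 2 := by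
    rw [h.hasDim_iff]
    lia
  constructor
  · rintro ⟨hne, ⟨-, U, hU, hS, hT⟩ | ⟨hk', -⟩⟩
    · exact ⟨hne, U.1, U.2, (hasDim_iff_rk U).mp hU, hS, hT⟩
    · lia
  · rintro ⟨hne, U, hU, hr, hS, hT⟩
    exact ⟨hne, Or.inl ⟨hk, ⟨U, hU⟩, (hasDim_iff_rk _).mpr hr, hS, hT⟩⟩

theorem adj_iff_rk_inter (hk : k + 1 = n) (S T : X.Grassmannian k) :
    (X.grassmannGraph n k).Adj S T ↔ S ≠ T ∧ X.rk (S.1.1 ∩ T.1.1) = k := by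
  have hasDim_iff_rk : (S.1.inter T.1).HasDim ((n : ℤ) - 2) ↔ X.rk (S.1.1 ∩ T.1.1) = k := by
    rw [h.hasDim_iff, SingularSubspace.inter]
    lia
  constructor
  · rintro ⟨hne, ⟨hk', -⟩ | ⟨-, hI⟩⟩
    · lia
    · exact ⟨hne, hasDim_iff_rk.mp hI⟩
  · rintro ⟨hne, hr⟩
    exact ⟨hne, Or.inr ⟨hk, hasDim_iff_rk.mpr hr⟩⟩

theorem le_rk_inter_of_adj (hk : k < n) (hST : (X.grassmannGraph n k).Adj S T) :
    k ≤ X.rk (S.1.1 ∩ T.1.1) := by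
  rcases Nat.lt_or_ge (k + 1) n with hk' | hk'
  · obtain ⟨U, hU, hr, hSU, hTU⟩ := ((h.adj_iff_joint hk' S T).mp hST).2
    have hle := h.rk_le_rk_inter S.1.2 T.1.2 hU hSU hTU (by rw [hr, h.rk_grassmannian])
    rw [h.rk_grassmannian] at hle
    lia
  · exact ((h.adj_iff_rk_inter (by lia) S T).mp hST).2.ge

theorem le_rk_inter_add_length (hk : k < n) (w : (X.grassmannGraph n k).Walk S T) :
    k + 1 ≤ X.rk (S.1.1 ∩ T.1.1) + w.length := by
  induction w with
  | @nil S => rw [Set.inter_self, h.rk_grassmannian, SimpleGraph.Walk.length_nil]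
  | @cons S S' T hadj w ih =>
    have hS' := h.rk_grassmannian S'
    have hle := h.rk_le_rk_inter (S'.1.2.inter T.1.2.1) (S'.1.2.inter S.1.2.1) S'.1.2
      Set.inter_subset_left Set.inter_subset_left
      (by have := h.le_rk_inter_of_adj hk hadj.symm; lia)
    have hmono : X.rk (S'.1.1 ∩ T.1.1 ∩ (S'.1.1 ∩ S.1.1)) ≤ X.rk (S.1.1 ∩ T.1.1) :=
      h.rk_mono ((S'.1.2.inter T.1.2.1).inter (S'.1.2.1.inter S.1.2.1)) (S.1.2.inter T.1.2.1)
        fun x hx => ⟨hx.2.2, hx.1.2⟩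
    rw [SimpleGraph.Walk.length_cons]
    lia

theorem not_opposite_of_edist_le (hk : k + 2 ≤ n)
    (hd : (X.grassmannGraph n k).edist S T ≤ (k + 1 : ℕ)) : ¬ X.Opposite S.1.1 T.1.1 := by
  obtain ⟨w, hw⟩ := exists_walk_of_edist_le hd
  rw [Opposite, Set.not_disjoint_iff]
  cases w with
  | nil =>
    obtain ⟨p, hp⟩ := h.nonempty_of_rk_pos (A := S.1.1) (by rw [h.rk_grassmannian]; lia)
    exact ⟨p, hp, S.1.2.subset_perp hp⟩
  | @cons _ S' _ hadj w =>
    have hle := h.le_rk_inter_add_length (by lia) w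
    rw [SimpleGraph.Walk.length_cons] at hw
    obtain ⟨p, hpS', hpT⟩ := h.nonempty_of_rk_pos (A := S'.1.1 ∩ T.1.1) (by lia)
    obtain ⟨-, U, hU, -, hSU, hS'U⟩ := (h.adj_iff_joint hk S S').mp hadj
    exact ⟨p, hpT, hU.mem_perp (hS'U hpS') hSU⟩

theorem not_opposite_of_edist_le_of_maximal (hk : k + 1 = n)
    (hd : (X.grassmannGraph n k).edist S T ≤ k) : ¬ X.Opposite S.1.1 T.1.1 := by
  obtain ⟨w, hw⟩ := exists_walk_of_edist_le hd
  have hle := h.le_rk_inter_add_length (by lia) w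
  obtain ⟨p, hpS, hpT⟩ := h.nonempty_of_rk_pos (A := S.1.1 ∩ T.1.1) (by lia)
  exact Set.not_disjoint_iff.mpr ⟨p, hpT, S.1.2.subset_perp hpS⟩

theorem adj_of_subset_span_insert (hk : k + 2 ≤ n) (hp : p ∈ X.perp S.1.1) (hpS : p ∉ S.1.1)
    (hST : S ≠ T) (hT : T.1.1 ⊆ X.span (insert p S.1.1)) : (X.grassmannGraph n k).Adj S T :=
  (h.adj_iff_joint hk S T).mpr ⟨hST, _, h.isSingularSubspace_span_insert S.1.2 hp,
    by rw [h.rk_span_insert S.1.2 hp hpS, h.rk_grassmannian], X.subset_span_insert p S.1.1, hT⟩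

/-- The first step of a geodesic from `S` to `T` if some point `p` of `T` outside `S` is collinear
to all points of `S`: replace `S` by the span of `p` and a hyperplane of `S` in `q^⊥`. -/
theorem exists_adj_of_mem_perp (hk : k + 2 ≤ n) (hpT : p ∈ T.1.1) (hpS : p ∉ S.1.1)
    (hp : p ∈ X.perp S.1.1) (hqT : q ∈ T.1.1) (hq : q ∉ X.span (insert p (S.1.1 ∩ T.1.1))) :
    ∃ S', (X.grassmannGraph n k).Adj S S' ∧ X.rk (S.1.1 ∩ T.1.1) < X.rk (S'.1.1 ∩ T.1.1) ∧
      q ∉ S'.1.1 ∧ q ∈ X.perp S'.1.1 := by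
  have hI : X.IsSingularSubspace (S.1.1 ∩ T.1.1) := S.1.2.inter T.1.2.1
  have hIk : X.rk (S.1.1 ∩ T.1.1) ≤ k := by
    by_contra hk'
    exact hpS (h.grassmannian_eq_of_rk_inter (S := S) (T := T) (by lia) ▸ hpT)
  have hrS := h.rk_grassmannian S
  have hle := h.rk_le_rk_inter_perp S.1.2 q
  obtain ⟨H, hH, hIH, hHq, hrH⟩ := h.exists_between hI (S.1.2.inter (h.isSubspace_perp {q}))
    (Set.subset_inter Set.inter_subset_left (subset_perp_singleton.mpr
      (T.1.2.mem_perp hqT Set.inter_subset_right))) hIk (by lia)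
  have hHS : H ⊆ S.1.1 := hHq.trans Set.inter_subset_left
  have hpH : p ∈ X.perp H := perp_anti hHS hp
  let S' := h.vertex (h.isSingularSubspace_span_insert hH hpH)
    (by rw [h.rk_span_insert hH hpH fun hp => hpS (hHS hp), hrH])
  have hpS' : p ∈ S'.1.1 := X.mem_span_insert_self p H
  have hIS' : S.1.1 ∩ T.1.1 ⊆ S'.1.1 ∩ T.1.1 :=
    Set.subset_inter (hIH.trans (X.subset_span_insert p H)) Set.inter_subset_right
  refine ⟨S', h.adj_of_subset_span_insert hk hp hpS (fun hSS' => hpS (hSS' ▸ hpS'))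
    (span_mono (Set.insert_subset_insert hHS)), h.rk_lt hI (S'.1.2.inter T.1.2.1)
    ⟨hIS', fun hle => hpS (hle ⟨hpS', hpT⟩).1⟩, fun hqS' => hq ?_, ?_⟩
  · have hS'T := h.eq_span_insert_inter h.nondegenerateOn_univ hH (S'.1.2.1.inter T.1.2.1) hpH
      (fun hp => hpS (hHS hp)) ⟨hpS', hpT⟩ Set.inter_subset_left
    have hqS'T : q ∈ S'.1.1 ∩ T.1.1 := ⟨hqS', hqT⟩
    rw [hS'T] at hqS'T
    exact span_mono (Set.insert_subset_insert
      (Set.inter_subset_inter hHS Set.inter_subset_right)) hqS'T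
  · change q ∈ X.perp (X.span (insert p H))
    rw [h.perp_span, mem_perp_insert]
    exact ⟨T.1.2.2 q hqT p hpT, subset_perp_singleton.mp (hHq.trans Set.inter_subset_right)⟩

theorem edist_le_of_mem_perp (hk : k + 2 ≤ n) (S T : X.Grassmannian k)
    (hm : k + 1 ≤ X.rk (S.1.1 ∩ T.1.1) + m) (hpT : p ∈ T.1.1) (hpS : p ∉ S.1.1)
    (hp : p ∈ X.perp S.1.1) : (X.grassmannGraph n k).edist S T ≤ m := by
  have hST : S ≠ T := fun hST => hpS (hST ▸ hpT)
  induction m generalizing S p with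
  | zero => exact absurd (h.grassmannian_eq_of_rk_inter hm) hST
  | succ m ih =>
    by_cases hT : T.1.1 ⊆ X.span (insert p (S.1.1 ∩ T.1.1))
    · rw [SimpleGraph.edist_eq_one_iff_adj.mpr (h.adj_of_subset_span_insert hk hp hpS hST
        (hT.trans (span_mono (Set.insert_subset_insert Set.inter_subset_left))))]
      exact_mod_cast Nat.le_add_left 1 m
    · obtain ⟨q, hqT, hq⟩ := Set.not_subset.mp hT
      obtain ⟨S', hadj, hlt, hqS', hqS'perp⟩ :=
        h.exists_adj_of_mem_perp hk hpT hpS hp hqT hq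
      exact edist_le_succ_of_adj hadj
        (ih S' (by lia) hqT hqS' hqS'perp fun hS'T => hqS' (hS'T ▸ hqT))

theorem exists_adj_of_notMem_perp (hk : k + 2 ≤ n) (hqT : q ∈ T.1.1) (hq : q ∉ X.perp S.1.1) :
    ∃ S', (X.grassmannGraph n k).Adj S S' ∧ X.rk (S.1.1 ∩ T.1.1) ≤ X.rk (S'.1.1 ∩ T.1.1) ∧
      q ∉ S'.1.1 ∧ q ∈ X.perp S'.1.1 := by
  have hrS := h.rk_grassmannian S
  obtain ⟨p, hp, hpS⟩ := h.exists_mem_perp_notMem S.1.2 (by lia)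
  have hU := h.isSingularSubspace_span_insert S.1.2 hp
  have hrU := h.rk_span_insert S.1.2 hp hpS
  have hSU := X.subset_span_insert p S.1.1
  have hI : X.IsSingularSubspace (S.1.1 ∩ T.1.1) := S.1.2.inter T.1.2.1
  have hIS := h.rk_mono hI S.1.2 Set.inter_subset_left
  have hle := h.rk_le_rk_inter_perp hU q
  obtain ⟨H, hH, hIH, hHq, hrH⟩ := h.exists_between (m := k + 1) hI
    (hU.inter (h.isSubspace_perp {q}))
    (Set.subset_inter (Set.inter_subset_left.trans hSU) (subset_perp_singleton.mpr
      (T.1.2.mem_perp hqT Set.inter_subset_right))) (by lia) (by lia)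
  have hHU : H ⊆ X.span (insert p S.1.1) := hHq.trans Set.inter_subset_left
  have hqH : q ∈ X.perp H := subset_perp_singleton.mp (hHq.trans Set.inter_subset_right)
  refine ⟨h.vertex hH hrH, h.adj_of_subset_span_insert hk hp hpS ?_ hHU,
    h.rk_mono hI (hH.inter T.1.2.1) (Set.subset_inter hIH Set.inter_subset_right),
    fun hqH' => hq (hU.mem_perp (hHU hqH') hSU), hqH⟩
  rintro rfl
  exact hq hqH

theorem edist_le_of_rk_inter (hk : k + 2 ≤ n) (S T : X.Grassmannian k)
    (hm : k + 1 ≤ X.rk (S.1.1 ∩ T.1.1) + m) :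
    (X.grassmannGraph n k).edist S T ≤ (m + 1 : ℕ) := by
  by_cases hTS : T.1.1 ⊆ S.1.1
  · rw [h.grassmannian_eq_of_subset hTS, SimpleGraph.edist_self]
    exact zero_le
  obtain ⟨q, hqT, hqS⟩ := Set.not_subset.mp hTS
  by_cases hq : q ∈ X.perp S.1.1
  · refine (h.edist_le_of_mem_perp hk S T hm hqT hqS hq).trans ?_
    exact_mod_cast Nat.le_succ m
  · obtain ⟨S', hadj, hle, hqS', hqS'perp⟩ := h.exists_adj_of_notMem_perp hk hqT hq
    exact edist_le_succ_of_adj hadj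
      (h.edist_le_of_mem_perp hk S' T (hm.trans (by lia)) hqT hqS' hqS'perp)

theorem edist_le_of_not_opposite (hk : k + 2 ≤ n) (hST : ¬ X.Opposite S.1.1 T.1.1) :
    (X.grassmannGraph n k).edist S T ≤ (k + 1 : ℕ) := by
  obtain ⟨p, hpT, hp⟩ := Set.not_disjoint_iff.mp hST
  by_cases hpS : p ∈ S.1.1
  · have := h.rk_pos (S.1.2.inter T.1.2.1) ⟨p, hpS, hpT⟩
    exact h.edist_le_of_rk_inter hk S T (by lia)
  · exact h.edist_le_of_mem_perp hk S T (by lia) hpT hpS hp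

theorem exists_adj_of_maximal (hk : k + 1 = n) (hTS : ¬ T.1.1 ⊆ S.1.1) :
    ∃ S', (X.grassmannGraph n k).Adj S S' ∧ X.rk (S.1.1 ∩ T.1.1) < X.rk (S'.1.1 ∩ T.1.1) := by
  obtain ⟨q, hqT, hqS⟩ := Set.not_subset.mp hTS
  have hH : X.IsSingularSubspace (S.1.1 ∩ X.perp {q}) := S.1.2.inter (h.isSubspace_perp _)
  have hqH : q ∈ X.perp (S.1.1 ∩ X.perp {q}) := subset_perp_singleton.mp Set.inter_subset_right
  have hc := h.isSingularSubspace_span_insert hH hqH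
  have hrS := h.rk_grassmannian S
  have hrc := h.rk_span_insert hH hqH fun hq => hqS hq.1
  have hrH : X.rk (S.1.1 ∩ X.perp {q}) = k := by
    have := h.rk_le_rk_inter_perp S.1.2 q
    have := h.rk_le hc
    lia
  let S' := h.vertex hc (by rw [hrc, hrH])
  have hqS' : q ∈ S'.1.1 := X.mem_span_insert_self q _
  have hHS' : S.1.1 ∩ X.perp {q} ⊆ S'.1.1 := X.subset_span_insert q _
  have hSS' : S ≠ S' := fun hSS' => hqS (hSS' ▸ hqS')
  refine ⟨S', (h.adj_iff_rk_inter hk S S').mpr ⟨hSS', le_antisymm ?_ ?_⟩,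
    h.rk_lt (S.1.2.inter T.1.2.1) (S'.1.2.inter T.1.2.1)
      ⟨fun x hx => ⟨hHS' ⟨hx.1, ?_⟩, hx.2⟩, fun hle => hqS (hle ⟨hqS', hqT⟩).1⟩⟩
  · by_contra hlt
    exact hSS' (h.grassmannian_eq_of_rk_inter (by lia))
  · exact hrH.ge.trans (h.rk_mono hH (S.1.2.inter S'.1.2.1)
      (Set.subset_inter Set.inter_subset_left hHS'))
  · exact mem_perp_singleton.mpr (T.1.2.2 x hx.2 q hqT)

theorem edist_le_of_rk_inter_of_maximal (hk : k + 1 = n) (S T : X.Grassmannian k)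
    (hm : k + 1 ≤ X.rk (S.1.1 ∩ T.1.1) + m) : (X.grassmannGraph n k).edist S T ≤ m := by
  by_cases hTS : T.1.1 ⊆ S.1.1
  · rw [h.grassmannian_eq_of_subset hTS, SimpleGraph.edist_self]
    exact zero_le
  induction m generalizing S with
  | zero => exact absurd (h.grassmannian_eq_of_rk_inter hm ▸ subset_rfl) hTS
  | succ m ih =>
    obtain ⟨S', hadj, hlt⟩ := h.exists_adj_of_maximal hk hTS
    refine edist_le_succ_of_adj hadj ?_
    by_cases hTS' : T.1.1 ⊆ S'.1.1
    · rw [h.grassmannian_eq_of_subset hTS', SimpleGraph.edist_self]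
      exact zero_le
    · exact ih S' (by lia) hTS'

theorem edist_le_of_not_opposite_of_maximal (hk : k + 1 = n) (hST : ¬ X.Opposite S.1.1 T.1.1) :
    (X.grassmannGraph n k).edist S T ≤ k := by
  obtain ⟨p, hpT, hp⟩ := Set.not_disjoint_iff.mp hST
  have hpS : p ∈ S.1.1 := h.mem_of_mem_perp S.1.2 (by rw [h.rk_grassmannian, hk]) hp
  have := h.rk_pos (S.1.2.inter T.1.2.1) ⟨p, hpS, hpT⟩
  exact h.edist_le_of_rk_inter_of_maximal hk S T (by lia)

theorem edist_le_iff_not_opposite (hk : k < n) (S T : X.Grassmannian k) :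
    (X.grassmannGraph n k).edist S T ≤ (if k + 1 = n then k else k + 1 : ℕ) ↔
      ¬ X.Opposite S.1.1 T.1.1 := by
  split_ifs with hk'
  · exact ⟨h.not_opposite_of_edist_le_of_maximal hk', h.edist_le_of_not_opposite_of_maximal hk'⟩
  · exact ⟨h.not_opposite_of_edist_le (by lia), h.edist_le_of_not_opposite (by lia)⟩

end IsWeakPolarSpace

end

/-! ### Cross-polytopes and thin polar spaces -/

section

variable {P Q : Type*} {m n k : ℕ} {c i j : Fin n × Bool} {R S T : Finset (Fin n × Bool)}

@[simp] theorem antipode_antipode (i : Fin n × Bool) : antipode (antipode i) = i := by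
  simp only [antipode, Bool.not_not]

theorem antipode_ne (i : Fin n × Bool) : antipode i ≠ i :=
  fun hi => Bool.not_ne_self _ (congrArg Prod.snd hi)

theorem antipode_injective : Function.Injective (antipode (n := n)) :=
  Function.Involutive.injective antipode_antipode

theorem antipode_eq_iff : antipode i = j ↔ i = antipode j :=
  ⟨fun hij => by rw [← hij, antipode_antipode], fun hij => by rw [hij, antipode_antipode]⟩

theorem eq_or_eq_antipode (hij : i.1 = j.1) : i = j ∨ i = antipode j :=
  (Bool.eq_or_eq_not i.2 j.2).imp (Prod.ext hij) (Prod.ext hij)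

/-- The faces with `m` vertices of the cross-polytope with vertices `±1, …, ±n`. -/
structure IsFace (m : ℕ) (S : Finset (Fin n × Bool)) : Prop where
  antipode_notMem : ∀ i ∈ S, antipode i ∉ S
  card_eq : S.card = m

/-- The image of a set of vertices of the cross-polytope under the antipodal map. -/
def opp (S : Finset (Fin n × Bool)) : Finset (Fin n × Bool) := S.image antipode

theorem mem_opp : i ∈ opp S ↔ antipode i ∈ S := by
  simp only [opp, Finset.mem_image, antipode_eq_iff, exists_eq_right]

@[simp] theorem opp_opp (S : Finset (Fin n × Bool)) : opp (opp S) = S := by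
  ext i
  rw [mem_opp, mem_opp, antipode_antipode]

theorem card_opp (S : Finset (Fin n × Bool)) : (opp S).card = S.card :=
  Finset.card_image_of_injective _ antipode_injective

theorem opp_erase (S : Finset (Fin n × Bool)) (i : Fin n × Bool) :
    opp (S.erase i) = (opp S).erase (antipode i) := by
  ext j
  simp only [mem_opp, Finset.mem_erase, ne_eq, antipode_eq_iff]

namespace IsFace

protected theorem opp (hS : IsFace m S) : IsFace m (opp S) :=
  ⟨fun _ hi hi' => hS.antipode_notMem _ (mem_opp.mp hi) (mem_opp.mp hi'),
    (card_opp S).trans hS.card_eq⟩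

theorem card_image_fst (hS : IsFace m S) : (S.image Prod.fst).card = m := by
  rw [← hS.card_eq]
  refine Finset.card_image_of_injOn fun i hi j hj hij => ?_
  obtain rfl | rfl := eq_or_eq_antipode hij
  · rfl
  · exact absurd hi (hS.antipode_notMem j hj)

theorem le (hS : IsFace m S) : m ≤ n := by
  rw [← hS.card_image_fst]
  exact card_finset_fin_le _

theorem exists_notMem (hS : IsFace m S) (hm : m < n) : ∃ c, c ∉ S ∧ antipode c ∉ S := by
  obtain ⟨i, -, hi⟩ := Finset.exists_mem_notMem_of_card_lt_card
    (s := S.image Prod.fst) (t := Finset.univ) (by rwa [hS.card_image_fst, Finset.card_fin])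
  exact ⟨(i, true), fun hmem => hi (Finset.mem_image_of_mem Prod.fst hmem),
    fun hmem => hi (Finset.mem_image_of_mem Prod.fst hmem)⟩

theorem mem_or_antipode_mem (hS : IsFace n S) (c : Fin n × Bool) : c ∈ S ∨ antipode c ∈ S := by
  have huniv : S.image Prod.fst = Finset.univ := by
    rw [← Finset.card_eq_iff_eq_univ, hS.card_image_fst, Fintype.card_fin]
  obtain ⟨i, hi, hic⟩ := Finset.mem_image.mp (huniv ▸ Finset.mem_univ c.1)
  obtain rfl | rfl := eq_or_eq_antipode hic
  · exact Or.inl hi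
  · exact Or.inr hi

protected theorem insert (hS : IsFace m S) (hc : c ∉ S) (hc' : antipode c ∉ S) :
    IsFace (m + 1) (insert c S) := by
  refine ⟨?_, by rw [Finset.card_insert_of_notMem hc, hS.card_eq]⟩
  simp only [Finset.mem_insert, not_or, forall_eq_or_imp]
  refine ⟨⟨antipode_ne c, hc'⟩, fun i hi => ⟨fun hic => hc' ?_, hS.antipode_notMem i hi⟩⟩
  rwa [← antipode_eq_iff.mp hic]

protected theorem erase (hS : IsFace (m + 1) S) (ha : a ∈ S) : IsFace m (S.erase a) :=
  ⟨fun i hi hi' => hS.antipode_notMem i (Finset.mem_of_mem_erase hi)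
    (Finset.mem_of_mem_erase hi'), by rw [Finset.card_erase_of_mem ha, hS.card_eq]; rfl⟩

theorem of_insert (hS : IsFace (m + 1) (insert c S)) (hc : c ∉ S) : IsFace m S := by
  have := hS.erase (Finset.mem_insert_self c S)
  rwa [Finset.erase_insert hc] at this

theorem antipode_notMem_of_insert (hS : IsFace m (insert c S)) : antipode c ∉ S :=
  fun hc => hS.antipode_notMem c (Finset.mem_insert_self c S) (Finset.mem_insert_of_mem hc)

theorem insert_antipode (hS : IsFace (m + 1) (insert c S)) (hc : c ∉ S) :
    IsFace (m + 1) (insert (antipode c) S) :=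
  (hS.of_insert hc).insert hS.antipode_notMem_of_insert (by rwa [antipode_antipode])

theorem mono (hS : IsFace m S) (hTS : T ⊆ S) : IsFace T.card T :=
  ⟨fun i hi hi' => hS.antipode_notMem i (hTS hi) (hTS hi'), rfl⟩

end IsFace

/-- `p` labels the points of `Y` by the vertices `±1, …, ±n` of the cross-polytope such that the
lines of `Y` are the images of the edges. -/
def IsThinParam (Y : PartialLinearSpace Q) (p : (Fin n × Bool) ≃ Q) : Prop :=
  ∀ L, L ∈ Y.lines ↔ ∃ i j, i ≠ j ∧ j ≠ antipode i ∧ L = {p i, p j}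

theorem IsThinPolarSpace.exists_isThinParam {Y : PartialLinearSpace Q}
    (hY : Y.IsThinPolarSpace n) : ∃ p : (Fin n × Bool) ≃ Q, Y.IsThinParam p := by
  obtain ⟨hn, α, hα⟩ := hY
  refine ⟨α.symm, fun L => ?_⟩
  have hL : L ∈ Y.lines ↔ α '' L ∈ (thinPolarSpace n hn).lines := by
    rw [← hα, α.injective.image_injective.mem_set_image]
  rw [hL]
  refine exists₂_congr fun i j => and_congr_right fun _ => and_congr_right fun _ => ?_
  rw [← Set.image_pair, Equiv.eq_image_iff_symm_image_eq, Equiv.symm_symm]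

namespace IsThinParam

variable {Y : PartialLinearSpace Q} {p : (Fin n × Bool) ≃ Q}

theorem exists_finset (p : (Fin n × Bool) ≃ Q) (A : Set Q) :
    ∃ S : Finset (Fin n × Bool), A = p '' S := by
  classical
  refine ⟨Set.toFinset (p ⁻¹' A), ?_⟩
  rw [Set.coe_toFinset, Set.image_preimage_eq _ p.surjective]

variable (hp : Y.IsThinParam p)
include hp

theorem collinear_iff : Y.Collinear (p i) (p j) ↔ j ≠ antipode i := by
  constructor
  · rintro ⟨L, hL, hi, hj⟩ rfl
    obtain ⟨a, b, hab, hb, rfl⟩ := (hp L).mp hL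
    simp only [Set.mem_insert_iff, Set.mem_singleton_iff, p.injective.eq_iff] at hi hj
    obtain rfl | rfl := hi <;> obtain hj | hj := hj
    · exact antipode_ne _ hj
    · exact hb hj.symm
    · exact hb (antipode_eq_iff.mp hj)
    · exact antipode_ne _ hj
  · intro hj
    by_cases hij : i = j
    · exact hij ▸ Y.collinear_refl _
    · exact ⟨{p i, p j}, (hp _).mpr ⟨i, j, hij, hj, rfl⟩, Or.inl rfl, Or.inr rfl⟩

theorem isShultSpace : Y.IsShultSpace where
  one_or_all := by
    intro q L hL
    obtain ⟨i, j, hij, -, rfl⟩ := (hp L).mp hL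
    obtain ⟨l, rfl⟩ := p.surjective q
    by_cases hi : i = antipode l
    · refine Or.inl ⟨p j, ⟨Or.inr rfl, hp.collinear_iff.mpr fun hj => hij (hi.trans hj.symm)⟩, ?_⟩
      rintro _ ⟨rfl | rfl, hc⟩
      · exact absurd hi (hp.collinear_iff.mp hc)
      · rfl
    by_cases hj : j = antipode l
    · refine Or.inl ⟨p i, ⟨Or.inl rfl, hp.collinear_iff.mpr hi⟩, ?_⟩
      rintro _ ⟨rfl | rfl, hc⟩
      · rfl
      · exact absurd hj (hp.collinear_iff.mp hc)
    · right
      rintro _ (rfl | rfl)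
      · exact hp.collinear_iff.mpr hi
      · exact hp.collinear_iff.mpr hj

theorem isSubspace (A : Set Q) : Y.IsSubspace A := by
  intro a ha b hb hab L hL haL hbL
  obtain ⟨i, j, -, -, rfl⟩ := (hp L).mp hL
  obtain rfl | rfl := haL <;> obtain rfl | rfl := hbL
  · exact absurd rfl hab
  · exact Set.pair_subset ha hb
  · exact Set.pair_subset hb ha
  · exact absurd rfl hab

theorem isSingularSubspace_iff : Y.IsSingularSubspace (p '' S) ↔ IsFace S.card S := by
  constructor
  · rintro ⟨-, hS⟩
    exact ⟨fun i hi hi' => hp.collinear_iff.mp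
      (hS _ (Set.mem_image_of_mem p hi) _ (Set.mem_image_of_mem p hi')) rfl, rfl⟩
  · intro hS
    refine ⟨hp.isSubspace _, ?_⟩
    rintro _ ⟨i, hi, rfl⟩ _ ⟨j, hj, rfl⟩
    refine hp.collinear_iff.mpr ?_
    rintro rfl
    exact hS.antipode_notMem i hi hj

omit hp in
theorem height_le (hS : Y.IsSingularSubspace (p '' S)) :
    Order.height (⟨_, hS⟩ : Y.SingularSubspace) ≤ S.card := by
  have : Finite Q := Finite.of_equiv _ p
  have hmono : StrictMono fun A : Y.SingularSubspace => A.1.ncard :=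
    fun A B hAB => Set.ncard_lt_ncard hAB (Set.toFinite _)
  refine (Order.height_le_height_apply_of_strictMono _ hmono ⟨_, hS⟩).trans ?_
  rw [Order.height_nat, Set.ncard_image_of_injective _ p.injective, Set.ncard_coe_finset]

theorem le_height (hS : Y.IsSingularSubspace (p '' S)) :
    S.card ≤ Order.height (⟨_, hS⟩ : Y.SingularSubspace) := by
  induction S using Finset.induction_on with
  | empty => simp only [Finset.card_empty, Nat.cast_zero, zero_le]
  | insert a S ha ih =>
    have hS' : Y.IsSingularSubspace (p '' S) := hp.isSingularSubspace_iff.mpr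
      ((hp.isSingularSubspace_iff.mp hS).mono (Finset.subset_insert a S))
    have hlt : (⟨_, hS'⟩ : Y.SingularSubspace) < ⟨_, hS⟩ := by
      exact p.injective.image_strictMono (mod_cast Finset.ssubset_insert ha)
    rw [Finset.card_insert_of_notMem ha, Nat.cast_add_one]
    exact (add_le_add_left (ih hS') 1).trans (Order.height_add_one_le hlt)

theorem height_eq (hS : Y.IsSingularSubspace (p '' S)) :
    Order.height (⟨_, hS⟩ : Y.SingularSubspace) = S.card :=
  (height_le hS).antisymm (hp.le_height hS)

theorem rk_eq (hS : IsFace m S) : Y.rk (p '' S) = m := by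
  obtain ⟨-, rfl⟩ := id hS
  rw [rk, dif_pos (hp.isSingularSubspace_iff.mpr hS), hp.height_eq]
  rfl

theorem isFace_of_isMax (hS : Y.IsSingularSubspace (p '' S))
    (hmax : IsMax (⟨_, hS⟩ : Y.SingularSubspace)) : IsFace n S := by
  have hface := hp.isSingularSubspace_iff.mp hS
  refine ⟨hface.antipode_notMem, hface.le.antisymm ?_⟩
  by_contra! hlt
  obtain ⟨c, hc, hc'⟩ := hface.exists_notMem hlt
  have hcS := hp.isSingularSubspace_iff.mpr ((hface.insert hc hc').mono subset_rfl)
  have hle := hmax (b := ⟨_, hcS⟩) (Set.image_mono (mod_cast Finset.subset_insert c S))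
  exact hc (p.injective.mem_set_image.mp (hle ⟨c, Finset.mem_insert_self c S, rfl⟩))

theorem isWeakPolarSpace : Y.IsWeakPolarSpace n where
  one_or_all := hp.isShultSpace.one_or_all
  nondegenerate := by
    rintro ⟨q, hq⟩
    obtain ⟨i, rfl⟩ := p.surjective q
    exact hp.collinear_iff.mp (hq (p (antipode i))) rfl
  finite_chain C _ := by
    have : Finite Q := Finite.of_equiv _ p
    exact Set.toFinite C
  hasRank := by
    rintro ⟨A, hA⟩ hmax
    obtain ⟨S, rfl⟩ := exists_finset p A
    refine ⟨n, ?_, by ring⟩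
    rw [hp.height_eq, (hp.isFace_of_isMax hA hmax).card_eq]

theorem joint_iff : Y.Joint m (p '' S) (p '' T) ↔ ∃ W, IsFace m W ∧ S ⊆ W ∧ T ⊆ W := by
  constructor
  · rintro ⟨U, hU, rfl, hS, hT⟩
    obtain ⟨W, rfl⟩ := exists_finset p U
    have hW := hp.isSingularSubspace_iff.mp hU
    rw [Set.image_subset_image_iff p.injective, Finset.coe_subset] at hS hT
    exact ⟨W, by rwa [hp.rk_eq hW], hS, hT⟩
  · rintro ⟨W, hW, hS, hT⟩
    exact ⟨p '' W, hp.isSingularSubspace_iff.mpr (hW.mono subset_rfl), hp.rk_eq hW,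
      Set.image_mono (mod_cast hS), Set.image_mono (mod_cast hT)⟩

theorem opposite_iff (hS : IsFace m S) (hT : IsFace m T) :
    Y.Opposite (p '' S) (p '' T) ↔ T = opp S := by
  have mem_perp_iff (j : Fin n × Bool) : p j ∈ Y.perp (p '' S) ↔ j ∉ opp S := by
    simp only [perp, Set.mem_ofPred_eq, Set.forall_mem_image, hp.collinear_iff, mem_opp,
      Finset.mem_coe]
    refine ⟨fun hj hmem => hj hmem rfl, ?_⟩
    rintro hj i hi rfl
    exact hj hi
  rw [Opposite, Set.disjoint_left, Set.forall_mem_image]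
  simp only [mem_perp_iff, not_not]
  exact ⟨fun hsub => Finset.eq_of_subset_of_card_le hsub
    (by rw [card_opp, hS.card_eq, hT.card_eq]), fun hTS i hi => hTS ▸ hi⟩

/-- The vertex of the Grassmann graph of a thin polar space that corresponds to a face of the
cross-polytope. -/
def faceVertex (hS : IsFace (k + 1) S) : Y.Grassmannian k :=
  hp.isWeakPolarSpace.vertex (hp.isSingularSubspace_iff.mpr (hS.mono subset_rfl)) (hp.rk_eq hS)

theorem faceVertex_injective (hS : IsFace (k + 1) S) (hT : IsFace (k + 1) T)
    (hST : hp.faceVertex hS = hp.faceVertex hT) : S = T :=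
  Finset.coe_injective (p.injective.image_injective
    (congrArg (fun V : Y.Grassmannian k => V.1.1) hST))

theorem exists_eq_faceVertex (V : Y.Grassmannian k) :
    ∃ (S : Finset (Fin n × Bool)) (hS : IsFace (k + 1) S), V = hp.faceVertex hS := by
  obtain ⟨S, hS⟩ := exists_finset p V.1.1
  have hface : IsFace S.card S := hp.isSingularSubspace_iff.mp (hS ▸ V.1.2)
  exact ⟨S, ⟨hface.antipode_notMem, by
    rw [← hp.rk_eq hface, ← hS, hp.isWeakPolarSpace.rk_grassmannian]⟩,
    Subtype.ext (Subtype.ext hS)⟩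

theorem adj_faceVertex_insert_antipode (hkn : k + 1 = n) (hc : c ∉ R)
    (hR : IsFace (k + 1) (insert c R)) :
    (Y.grassmannGraph n k).Adj (hp.faceVertex hR) (hp.faceVertex (hR.insert_antipode hc)) := by
  rw [hp.isWeakPolarSpace.adj_iff_rk_inter hkn]
  refine ⟨fun heq => ?_, ?_⟩
  · have hmem := Finset.mem_insert_self c R
    rw [hp.faceVertex_injective _ _ heq] at hmem
    exact (Finset.mem_insert.mp hmem).elim (antipode_ne c).symm hc
  · have hinter : insert c R ∩ insert (antipode c) R = R := by
      rw [Finset.insert_inter_of_notMem (by simp [(antipode_ne c).symm, hc]),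
        Finset.inter_eq_left.mpr (Finset.subset_insert _ _)]
    change Y.rk (p '' _ ∩ p '' _) = k
    rw [← Set.image_inter p.injective, ← Finset.coe_inter, hinter, hp.rk_eq (hR.of_insert hc)]

end IsThinParam

theorem IsThinPolarSpace.isWeakPolarSpace {Y : PartialLinearSpace Q} (hY : Y.IsThinPolarSpace n) :
    Y.IsWeakPolarSpace n := by
  obtain ⟨_, hp⟩ := hY.exists_isThinParam
  exact hp.isWeakPolarSpace

/-- A family of singular subspaces of rank `k + 1` indexed by the faces with `k + 1` vertices of the
cross-polytope, with the adjacency and opposition relations of the faces. Its members are the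
vertices of the image of an isometric embedding of a thin polar Grassmann graph; the values at
other sets are irrelevant. -/
structure IsConfiguration (X : PartialLinearSpace P) (n k : ℕ)
    (x : Finset (Fin n × Bool) → Set P) : Prop where
  isSingularSubspace : ∀ S, IsFace (k + 1) S → X.IsSingularSubspace (x S)
  rk_eq : ∀ S, IsFace (k + 1) S → X.rk (x S) = k + 1
  joint_iff : ∀ S T, IsFace (k + 1) S → IsFace (k + 1) T →
    (X.Joint (k + 2) (x S) (x T) ↔ ∃ W, IsFace (k + 2) W ∧ S ⊆ W ∧ T ⊆ W)
  le_rk_inter : k + 1 = n → ∀ R c, c ∉ R → IsFace (k + 1) (insert c R) →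
    k ≤ X.rk (x (insert c R) ∩ x (insert (antipode c) R))
  opposite_iff : ∀ S T, IsFace (k + 1) S → IsFace (k + 1) T →
    (X.Opposite (x S) (x T) ↔ T = opp S)

theorem adj_iff_of_edist_eq {V W : Type*} {G : SimpleGraph V} {H : SimpleGraph W} {f : V → W}
    (hf : ∀ u v, H.edist (f u) (f v) = G.edist u v) (u v : V) :
    H.Adj (f u) (f v) ↔ G.Adj u v := by
  rw [← SimpleGraph.edist_eq_one_iff_adj, hf, SimpleGraph.edist_eq_one_iff_adj]

theorem injective_of_edist_eq {V W : Type*} {G : SimpleGraph V} {H : SimpleGraph W} {f : V → W}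
    (hf : ∀ u v, H.edist (f u) (f v) = G.edist u v) : Function.Injective f := by
  intro u v huv
  rw [← SimpleGraph.edist_eq_zero_iff (G := G), ← hf, huv, SimpleGraph.edist_self]

theorem IsWeakPolarSpace.joint_self {X : PartialLinearSpace P} (h : X.IsWeakPolarSpace n)
    (hk : k + 2 ≤ n) (V : X.Grassmannian k) : X.Joint (k + 2) V.1.1 V.1.1 := by
  have hV := h.rk_grassmannian V
  obtain ⟨q, hq, hqV⟩ := h.exists_mem_perp_notMem V.1.2 (by lia)
  exact ⟨_, h.isSingularSubspace_span_insert V.1.2 hq, by rw [h.rk_span_insert V.1.2 hq hqV, hV],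
    X.subset_span_insert q _, X.subset_span_insert q _⟩

theorem IsWeakPolarSpace.joint_iff_of_edist_eq {X : PartialLinearSpace P}
    {Y : PartialLinearSpace Q} (h : X.IsWeakPolarSpace n) (hY : Y.IsWeakPolarSpace n) (hk : k < n)
    {f : Y.Grassmannian k → X.Grassmannian k}
    (hf : ∀ U V, (X.grassmannGraph n k).edist (f U) (f V) = (Y.grassmannGraph n k).edist U V)
    (U V : Y.Grassmannian k) :
    X.Joint (k + 2) (f U).1.1 (f V).1.1 ↔ Y.Joint (k + 2) U.1.1 V.1.1 := by
  rcases Nat.lt_or_ge (k + 1) n with hkn | hkn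
  · obtain rfl | hUV := eq_or_ne U V
    · exact iff_of_true (h.joint_self hkn _) (hY.joint_self hkn _)
    · have hadj := adj_iff_of_edist_eq hf U V
      rwa [h.adj_iff_joint hkn, hY.adj_iff_joint hkn, and_iff_right hUV,
        and_iff_right ((injective_of_edist_eq hf).ne hUV)] at hadj
  · refine iff_of_false ?_ ?_
    · rintro ⟨W, hW, hr, -⟩
      have := h.rk_le hW
      lia
    · rintro ⟨W, hW, hr, -⟩
      have := hY.rk_le hW
      lia

theorem IsWeakPolarSpace.opposite_iff_of_edist_eq {X : PartialLinearSpace P}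
    {Y : PartialLinearSpace Q} (h : X.IsWeakPolarSpace n) (hY : Y.IsWeakPolarSpace n) (hk : k < n)
    {f : Y.Grassmannian k → X.Grassmannian k}
    (hf : ∀ U V, (X.grassmannGraph n k).edist (f U) (f V) = (Y.grassmannGraph n k).edist U V)
    (U V : Y.Grassmannian k) :
    X.Opposite (f U).1.1 (f V).1.1 ↔ Y.Opposite U.1.1 V.1.1 := by
  rw [← not_iff_not, ← h.edist_le_iff_not_opposite hk, hf, hY.edist_le_iff_not_opposite hk]

open Classical in
theorem IsThinParam.exists_isConfiguration {X : PartialLinearSpace P} {Y : PartialLinearSpace Q}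
    {p : (Fin n × Bool) ≃ Q} (hp : Y.IsThinParam p) (h : X.IsWeakPolarSpace n) (hk : k < n)
    {f : Y.Grassmannian k → X.Grassmannian k}
    (hf : ∀ U V, (X.grassmannGraph n k).edist (f U) (f V) = (Y.grassmannGraph n k).edist U V) :
    ∃ x : Finset (Fin n × Bool) → Set P, X.IsConfiguration n k x ∧
      Set.range f = {V | ∃ S, IsFace (k + 1) S ∧ V.1.1 = x S} := by
  have hY := hp.isWeakPolarSpace
  let x : Finset (Fin n × Bool) → Set P :=
    fun S => if hS : IsFace (k + 1) S then (f (hp.faceVertex hS)).1.1 else ∅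
  have hx {S} (hS : IsFace (k + 1) S) : x S = (f (hp.faceVertex hS)).1.1 := dif_pos hS
  refine ⟨x, ⟨fun S hS => ?_, fun S hS => ?_, fun S T hS hT => ?_, fun hkn R c hc hR => ?_,
    fun S T hS hT => ?_⟩, ?_⟩
  · exact hx hS ▸ (f (hp.faceVertex hS)).1.2
  · rw [hx hS, h.rk_grassmannian]
  · rw [hx hS, hx hT, h.joint_iff_of_edist_eq hY hk hf]
    exact hp.joint_iff
  · rw [hx hR, hx (hR.insert_antipode hc)]
    exact ((h.adj_iff_rk_inter hkn _ _).mp ((adj_iff_of_edist_eq hf _ _).mpr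
      (hp.adj_faceVertex_insert_antipode hkn hc hR))).2.ge
  · rw [hx hS, hx hT, h.opposite_iff_of_edist_eq hY hk hf]
    exact hp.opposite_iff hS hT
  · ext V
    constructor
    · rintro ⟨U, rfl⟩
      obtain ⟨S, hS, rfl⟩ := hp.exists_eq_faceVertex U
      exact ⟨S, hS, (hx hS).symm⟩
    · rintro ⟨S, hS, hV⟩
      exact ⟨hp.faceVertex hS, Subtype.ext (Subtype.ext (hV.trans (hx hS)).symm)⟩

end

/-! ### Hypercubes of maximal singular subspaces -/

section

variable {P : Type*} {m n k : ℕ} {a c i j : Fin n × Bool} {A S T V W : Finset (Fin n × Bool)}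

namespace IsFace

theorem singleton (i : Fin n × Bool) : IsFace 1 {i} :=
  ⟨fun j hj hj' => by
    rw [Finset.mem_singleton] at hj hj'
    exact antipode_ne j (hj'.trans hj.symm), Finset.card_singleton i⟩

theorem pair (hij : i ≠ j) (hj : j ≠ antipode i) : IsFace 2 {i, j} :=
  (singleton j).insert (by rwa [Finset.mem_singleton])
    (by rw [Finset.mem_singleton]; exact hj.symm)

theorem exists_superset (hS : IsFace m S) (hmk : m ≤ k) (hkn : k ≤ n) :
    ∃ W, IsFace k W ∧ S ⊆ W := by
  induction k, hmk using Nat.le_induction with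
  | base => exact ⟨S, hS, subset_rfl⟩
  | succ k _ ih =>
    obtain ⟨W, hW, hSW⟩ := ih (by lia)
    obtain ⟨c, hc, hc'⟩ := hW.exists_notMem (by lia)
    exact ⟨insert c W, hW.insert hc hc', hSW.trans (Finset.subset_insert c W)⟩

theorem exists_mem (i : Fin n × Bool) (hm : 0 < m) (hmn : m ≤ n) : ∃ W, IsFace m W ∧ i ∈ W := by
  obtain ⟨W, hW, hiW⟩ := (singleton i).exists_superset hm hmn
  exact ⟨W, hW, Finset.singleton_subset_iff.mp hiW⟩

theorem eq_of_subset (hS : IsFace m S) (hT : IsFace m T) (hST : S ⊆ T) : S = T :=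
  Finset.eq_of_subset_of_card_le hST (by rw [hS.card_eq, hT.card_eq])

theorem insert_erase (hW : IsFace m W) (ha : a ∈ W) (hc : c ∉ W.erase a)
    (hc' : antipode c ∉ W.erase a) : IsFace m (insert c (W.erase a)) := by
  cases m with
  | zero => simp only [Finset.card_eq_zero.mp hW.card_eq, Finset.notMem_empty] at ha
  | succ m => exact (hW.erase ha).insert hc hc'

theorem insert_antipode_erase (hW : IsFace m W) (hc : c ∈ W) :
    IsFace m (insert (antipode c) (W.erase c)) :=
  hW.insert_erase hc (fun hc' => hW.antipode_notMem c hc (Finset.mem_of_mem_erase hc'))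
    (by rw [antipode_antipode]; exact Finset.notMem_erase c W)

theorem exists_exchange (hW : IsFace m W) (hV : IsFace m V) (hc : c ∈ V) (hcW : c ∉ W) :
    ∃ a ∈ W, a ∉ V ∧ IsFace m (insert c (W.erase a)) := by
  by_cases hcW' : antipode c ∈ W
  · refine ⟨antipode c, hcW', hV.antipode_notMem c hc, ?_⟩
    simpa only [antipode_antipode] using hW.insert_antipode_erase hcW'
  · obtain ⟨a, haW, haV⟩ := Finset.not_subset.mp fun hWV => hcW (hW.eq_of_subset hV hWV ▸ hc)
    exact ⟨a, haW, haV, hW.insert_erase haW (fun hc' => hcW (Finset.mem_of_mem_erase hc'))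
      fun hc' => hcW' (Finset.mem_of_mem_erase hc')⟩

theorem exchange_induction {p : Finset (Fin n × Bool) → Prop}
    (hstep : ∀ R c d, A ⊆ R → c ∉ R → d ∉ R → IsFace m (insert c R) → IsFace m (insert d R) →
      p (insert c R) → p (insert d R))
    (hW : IsFace m W) (hV : IsFace m V) (hAW : A ⊆ W) (hAV : A ⊆ V) (hp : p W) : p V := by
  induction hr : (V \ W).card generalizing W with
  | zero =>
    rw [Finset.card_eq_zero, Finset.sdiff_eq_empty_iff_subset] at hr
    rwa [hV.eq_of_subset hW hr]
  | succ r ih =>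
    obtain ⟨c, hc⟩ : (V \ W).Nonempty := Finset.card_pos.mp (by lia)
    obtain ⟨hcV, hcW⟩ := Finset.mem_sdiff.mp hc
    obtain ⟨a, haW, haV, hF⟩ := hW.exists_exchange hV hcV hcW
    have hAR : A ⊆ W.erase a := fun i hi =>
      Finset.mem_erase.mpr ⟨fun hia => haV (hia ▸ hAV hi), hAW hi⟩
    refine ih hF (hAR.trans (Finset.subset_insert _ _)) ?_ ?_
    · rw [← Finset.insert_erase haW] at hW hp
      exact hstep _ a c hAR (Finset.notMem_erase a W)
        (fun hc => hcW (Finset.mem_of_mem_erase hc)) hW hF hp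
    · have hdiff : V \ insert c (W.erase a) = (V \ W).erase c := by grind
      rw [hdiff, Finset.card_erase_of_mem hc, hr, Nat.add_sub_cancel]

/-- An exchange of two antipodal vertices passes through a vertex not antipodal to either. -/
theorem exchange_induction_of_lt {p : Finset (Fin n × Bool) → Prop} (hm : m < n)
    (hstep : ∀ R c d, A ⊆ R → c ∉ R → d ∉ R → c ≠ d → IsFace (m + 1) (insert c (insert d R)) →
      p (insert c R) → p (insert d R))
    (hW : IsFace m W) (hV : IsFace m V) (hAW : A ⊆ W) (hAV : A ⊆ V) (hp : p W) : p V := by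
  refine exchange_induction (fun R c d hAR hc hd hFc hFd hp => ?_) hW hV hAW hAV hp
  have hstep' {c d : Fin n × Bool} (hc : c ∉ R) (hd : d ∉ R) (hFc : IsFace m (insert c R))
      (hFd : IsFace m (insert d R)) (hcd : d ≠ antipode c) (hp : p (insert c R)) :
      p (insert d R) := by
    obtain rfl | hne := eq_or_ne c d
    · exact hp
    · refine hstep R c d hAR hc hd hne (hFd.insert ?_ ?_) hp <;> rw [Finset.mem_insert, not_or]
      · exact ⟨hne, hc⟩
      · exact ⟨hcd.symm, hFc.antipode_notMem_of_insert⟩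
  obtain rfl | hcd := eq_or_ne d (antipode c)
  · obtain ⟨e, he, he'⟩ := hFc.exists_notMem hm
    rw [Finset.mem_insert, not_or] at he he'
    have hFe : IsFace m (insert e R) := by
      rw [← Finset.erase_insert hc]
      refine hFc.insert_erase (Finset.mem_insert_self c R) ?_ ?_ <;> rw [Finset.erase_insert hc]
      exacts [he.2, he'.2]
    refine hstep' he.2 hd hFe hFd (fun hce => he.1 (antipode_injective hce).symm) ?_
    exact hstep' hc he.2 hFc hFe (fun hce => he'.1 (antipode_eq_iff.mpr hce)) hp
  · exact hstep' hc hd hFc hFd hcd hp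

end IsFace

/-- `p` maps the vertices of the cross-polytope to the points of a frame. -/
def IsFrameMap (X : PartialLinearSpace P) (p : Fin n × Bool → P) : Prop :=
  ∀ i j, X.Collinear (p i) (p j) ↔ j ≠ antipode i

variable {X : PartialLinearSpace P} {p : Fin n × Bool → P} {x u : Finset (Fin n × Bool) → Set P}

namespace IsFrameMap

variable (hp : X.IsFrameMap p)
include hp

theorem injective : Function.Injective p := by
  intro i j hij
  by_contra hne
  have hi := (hp i (antipode i)).not.mpr (not_not.mpr rfl)
  rw [hij, hp, not_not] at hi
  exact hne (antipode_injective hi)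

theorem isFrame : X.IsFrame n (Set.range p) := by
  constructor
  · rw [← Set.image_univ, hp.injective.encard_image]
    simp [Set.encard_univ, mul_comm]
  · rintro _ ⟨i, rfl⟩
    refine ⟨p (antipode i), ⟨⟨_, rfl⟩, fun hc => (hp _ _).mp hc rfl⟩, ?_⟩
    rintro _ ⟨⟨j, rfl⟩, hj⟩
    rw [hp, not_not] at hj
    rw [hj]

theorem image_subset_perp (hS : IsFace m S) : p '' S ⊆ X.perp (p '' S) := by
  rintro _ ⟨i, hi, rfl⟩ _ ⟨j, hj, rfl⟩
  rw [hp]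
  rintro rfl
  exact hS.antipode_notMem i hi hj

theorem isSingularSubspace_span (h : X.IsShultSpace) (hS : IsFace m S) :
    X.IsSingularSubspace (X.span (p '' S)) :=
  h.isSingularSubspace_span (hp.image_subset_perp hS)

theorem notMem_span (h : X.IsShultSpace) (ha : a ∉ S) : p a ∉ X.span (p '' S) := by
  intro hmem
  have hperp : p '' S ⊆ X.perp {p (antipode a)} := by
    rintro _ ⟨i, hi, rfl⟩
    rw [mem_perp_singleton, hp]
    exact fun hia => ha (antipode_injective hia ▸ hi)
  exact (hp _ _).mp (mem_perp_singleton.mp (h.span_subset_perp hperp hmem)) rfl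

theorem rk_span (h : X.IsWeakPolarSpace n) (hS : IsFace m S) : X.rk (X.span (p '' S)) = m := by
  rw [h.rk_span_image (hp.image_subset_perp hS) fun a _ =>
    hp.notMem_span h.toIsShultSpace (Finset.notMem_erase a S), hS.card_eq]

theorem eq_span (h : X.IsWeakPolarSpace n) (hS : IsFace m S) {A : Set P}
    (hA : X.IsSingularSubspace A) (hr : X.rk A = m) (hpA : ∀ i ∈ S, p i ∈ A) :
    A = X.span (p '' S) :=
  (h.eq_of_subset (hp.isSingularSubspace_span h.toIsShultSpace hS) hA
    (span_subset hA.1 (Set.image_subset_iff.mpr hpA)) (by rw [hr, hp.rk_span h hS])).symm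

theorem isApartment (h : X.IsWeakPolarSpace n) (hx : X.IsConfiguration n k x)
    (hpx : ∀ S, IsFace (k + 1) S → ∀ i ∈ S, p i ∈ x S) :
    X.IsApartment n k {V | ∃ S, IsFace (k + 1) S ∧ V.1.1 = x S} := by
  have hspan {S} (hS : IsFace (k + 1) S) : x S = X.span (p '' S) :=
    hp.eq_span h hS (hx.isSingularSubspace S hS) (hx.rk_eq S hS) (hpx S hS)
  refine ⟨Set.range p, hp.isFrame, Set.ext fun V => ⟨?_, ?_⟩⟩
  · rintro ⟨S, hS, hV⟩
    exact ⟨p '' S, Set.image_subset_range _ _, hV.trans (hspan hS)⟩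
  · rintro ⟨A, hA, hV⟩
    obtain ⟨S, rfl⟩ := Set.subset_range_iff_exists_image_eq.mp hA
    lift S to Finset (Fin n × Bool) using S.toFinite
    have hSV : p '' S ⊆ V.1.1 := hV ▸ X.subset_span _
    have hS : IsFace S.card S := ⟨fun i hi hi' => (hp _ _).mp (V.1.2.2 _
      (hSV (Set.mem_image_of_mem p hi)) _ (hSV (Set.mem_image_of_mem p hi'))) rfl, rfl⟩
    have hcard : S.card = k + 1 := by
      rw [← hp.rk_span h hS, ← hV, h.rk_grassmannian]
    rw [hcard] at hS
    exact ⟨S, hS, by rw [hspan hS, hV]⟩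

end IsFrameMap

/-- A family of maximal singular subspaces indexed by the facets of the cross-polytope, that is, by
the vertices of a hypercube, in which neighbours meet in a hyperplane and opposite vertices are
disjoint. -/
structure IsHypercube (X : PartialLinearSpace P) (u : Finset (Fin n × Bool) → Set P) :
    Prop where
  isSingularSubspace : ∀ W, IsFace n W → X.IsSingularSubspace (u W)
  rk_eq : ∀ W, IsFace n W → X.rk (u W) = n
  le_rk_inter : ∀ W, IsFace n W → ∀ c ∈ W,
    n ≤ X.rk (u W ∩ u (insert (antipode c) (W.erase c))) + 1
  inter_opp : ∀ W, IsFace n W → u W ∩ u (opp W) = ∅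

theorem IsFace.insert_opp_erase (hW : IsFace m W) (hi : i ∈ W) :
    IsFace m (insert i (opp (W.erase i))) := by
  have hopp := hW.opp.insert_erase (c := i) (mem_opp.mpr ((antipode_antipode i).symm ▸ hi))
  rw [← opp_erase, mem_opp, mem_opp, antipode_antipode] at hopp
  exact hopp (fun hi' => hW.antipode_notMem i hi (Finset.mem_of_mem_erase hi'))
    (Finset.notMem_erase i W)

theorem IsFace.card_sdiff_add_card_sdiff (hW : IsFace n W) (hV : IsFace n V) (hiW : i ∈ W)
    (hiV : i ∈ V) : (W \ V).card + (V \ insert i (opp (W.erase i))).card + 1 = n := by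
  have hdiff : V \ insert i (opp (W.erase i)) = (W ∩ V).erase i := by
    ext j
    simp only [Finset.mem_sdiff, Finset.mem_insert, mem_opp, Finset.mem_erase, Finset.mem_inter]
    have hj := hW.mem_or_antipode_mem j
    have hj' := hW.antipode_notMem j
    have hji : antipode j = i → j ∉ V := fun hji hjV => hV.antipode_notMem j hjV (hji ▸ hiV)
    tauto
  have hi : i ∈ W ∩ V := Finset.mem_inter.mpr ⟨hiW, hiV⟩
  rw [hdiff, add_assoc, Finset.card_erase_add_one hi, Finset.card_sdiff_add_card_inter, hW.card_eq]

namespace IsHypercube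

variable (hu : X.IsHypercube u) (h : X.IsWeakPolarSpace n)
include hu h

theorem rk_le_rk_inter_add_card (hV : IsFace n V) (hW : IsFace n W) {A : Set P}
    (hA : X.IsSingularSubspace A) (hAV : A ⊆ u V) :
    X.rk A ≤ X.rk (A ∩ u W) + (V \ W).card := by
  induction hd : (V \ W).card generalizing V A with
  | zero =>
    rw [Finset.card_eq_zero, Finset.sdiff_eq_empty_iff_subset] at hd
    rw [← hV.eq_of_subset hW hd, Set.inter_eq_left.mpr hAV, add_zero]
  | succ d ih =>
    obtain ⟨c, hc⟩ : (V \ W).Nonempty := Finset.card_pos.mp (by lia)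
    obtain ⟨hcV, hcW⟩ := Finset.mem_sdiff.mp hc
    have hcW' : antipode c ∈ W := (hW.mem_or_antipode_mem c).resolve_left hcW
    have hV' := hV.insert_antipode_erase hcV
    set V' := insert (antipode c) (V.erase c)
    have hsV := hu.isSingularSubspace V hV
    have hsV' := hu.isSingularSubspace V' hV'
    have hsW := hu.isSingularSubspace W hW
    have hstep := h.rk_le_rk_inter hA (hsV.inter hsV'.1) hsV hAV Set.inter_subset_left
      (by rw [hu.rk_eq V hV]; exact hu.le_rk_inter V hV c hcV)
    rw [← Set.inter_assoc, Set.inter_eq_left.mpr hAV] at hstep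
    have hdiff : V' \ W = (V \ W).erase c := by
      rw [Finset.insert_sdiff_of_mem _ hcW', Finset.erase_sdiff_comm]
    have hrest := ih hV' (hA.inter hsV'.1) Set.inter_subset_right
      (by rw [hdiff, Finset.card_erase_of_mem hc, hd, Nat.add_sub_cancel])
    have hmono := h.rk_mono ((hA.inter hsV'.1).inter hsW.1) (hA.inter hsW.1)
      (Set.inter_subset_inter_left _ Set.inter_subset_left)
    lia

theorem nonempty_inter_inter (hW : IsFace n W) (hV : IsFace n V) (hiW : i ∈ W) (hiV : i ∈ V) :
    (u W ∩ u V ∩ u (insert i (opp (W.erase i)))).Nonempty := by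
  have hsW := hu.isSingularSubspace W hW
  have hsV := hu.isSingularSubspace V hV
  have hWV := hu.rk_le_rk_inter_add_card h hW hV hsW subset_rfl
  have hVW' := hu.rk_le_rk_inter_add_card h hV (hW.insert_opp_erase hiW) (hsW.inter hsV.1)
    Set.inter_subset_right
  have hcard := hW.card_sdiff_add_card_sdiff hV hiW hiV
  rw [hu.rk_eq W hW] at hWV
  exact h.nonempty_of_rk_pos (by lia)

theorem rk_inter_le_one (hW : IsFace n W) (hiW : i ∈ W) :
    X.rk (u W ∩ u (insert i (opp (W.erase i)))) ≤ 1 := by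
  have hW' := hW.insert_opp_erase hiW
  have hle := hu.rk_le_rk_inter_add_card h hW' hW.opp ((hu.isSingularSubspace W hW).inter
    (hu.isSingularSubspace _ hW').1) Set.inter_subset_right
  have hempty : u W ∩ u (insert i (opp (W.erase i))) ∩ u (opp W) = ∅ := by
    rw [Set.inter_right_comm, hu.inter_opp W hW, Set.empty_inter]
  have hsub : insert i (opp (W.erase i)) \ opp W ⊆ {i} := by
    intro j hj
    simp only [Finset.mem_sdiff, Finset.mem_insert, mem_opp, Finset.mem_erase] at hj
    exact Finset.mem_singleton.mpr (by tauto)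
  rw [hempty, h.rk_empty, zero_add] at hle
  exact hle.trans (Finset.card_le_card hsub)

/-- Every facet containing `i` lies on a geodesic between a fixed facet `W` containing `i` and the
facet meeting `W` in `i` only, so all their subspaces pass through one point. -/
theorem exists_mem_forall (i : Fin n × Bool) : ∃ q, ∀ W, IsFace n W → i ∈ W → q ∈ u W := by
  obtain ⟨W, hW, hiW⟩ := IsFace.exists_mem i i.1.pos le_rfl
  obtain ⟨q, ⟨hqW, -⟩, hqW'⟩ := hu.nonempty_inter_inter h hW hW hiW hiW
  refine ⟨q, fun V hV hiV => ?_⟩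
  obtain ⟨r, ⟨hrW, hrV⟩, hrW'⟩ := hu.nonempty_inter_inter h hW hV hiW hiV
  rwa [h.eq_of_mem_of_rk_le_one ((hu.isSingularSubspace W hW).inter
    (hu.isSingularSubspace _ (hW.insert_opp_erase hiW)).1) (hu.rk_inter_le_one h hW hiW)
    ⟨hqW, hqW'⟩ ⟨hrW, hrW'⟩]

omit h in
theorem notMem_of_antipode_mem (hp : ∀ i W, IsFace n W → i ∈ W → p i ∈ u W) (hW : IsFace n W)
    (hi : antipode i ∈ W) : p i ∉ u W := fun hpi => by
  have hmem : p i ∈ u W ∩ u (opp W) := ⟨hpi, hp i _ hW.opp (mem_opp.mpr hi)⟩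
  rwa [hu.inter_opp W hW] at hmem

theorem not_collinear_antipode (hp : ∀ i W, IsFace n W → i ∈ W → p i ∈ u W) :
    ¬ X.Collinear (p i) (p (antipode i)) := by
  intro hcol
  obtain ⟨W, hW, hiW⟩ := IsFace.exists_mem i i.1.pos le_rfl
  have hV := hW.insert_antipode_erase hiW
  have hiV : antipode i ∈ insert (antipode i) (W.erase i) := Finset.mem_insert_self _ _
  have hsW := hu.isSingularSubspace W hW
  have hsV := hu.isSingularSubspace _ hV
  have hspan := h.eq_span_insert (hsW.inter hsV.1) hsW Set.inter_subset_left
    (by rw [hu.rk_eq W hW]; exact hu.le_rk_inter W hW i hiW) (hp i W hW hiW)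
    fun hpi => hu.notMem_of_antipode_mem hp hV hiV hpi.2
  refine hu.notMem_of_antipode_mem hp hW (i := antipode i) ((antipode_antipode i).symm ▸ hiW)
    (h.mem_of_mem_perp hsW (hu.rk_eq W hW) ?_)
  rw [hspan, h.perp_span, mem_perp_insert]
  exact ⟨hcol.symm, hsV.mem_perp (hp _ _ hV hiV) Set.inter_subset_right⟩

theorem exists_isFrameMap :
    ∃ p : Fin n × Bool → P, X.IsFrameMap p ∧ ∀ i W, IsFace n W → i ∈ W → p i ∈ u W := by
  choose p hp using hu.exists_mem_forall h
  refine ⟨p, fun i j => ⟨?_, fun hij => ?_⟩, hp⟩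
  · rintro hcol rfl
    exact hu.not_collinear_antipode h hp hcol
  · obtain rfl | hne := eq_or_ne i j
    · exact X.collinear_refl _
    have hF := IsFace.pair hne hij
    obtain ⟨W, hW, hsub⟩ := hF.exists_superset hF.le le_rfl
    rw [Finset.insert_subset_iff, Finset.singleton_subset_iff] at hsub
    exact (hu.isSingularSubspace W hW).2 _ (hp i W hW hsub.1) _ (hp j W hW hsub.2)

end IsHypercube

namespace IsConfiguration

theorem isHypercube {x : Finset (Fin (k + 1) × Bool) → Set P}
    (hx : X.IsConfiguration (k + 1) k x) : X.IsHypercube x where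
  isSingularSubspace := hx.isSingularSubspace
  rk_eq := hx.rk_eq
  le_rk_inter W hW c hc := by
    have hle := hx.le_rk_inter rfl (W.erase c) c (Finset.notMem_erase c W)
    rw [Finset.insert_erase hc] at hle
    exact Nat.succ_le_succ (hle hW)
  inter_opp W hW := by
    have hopp := (hx.opposite_iff W (opp W) hW hW.opp).mpr rfl
    exact (hopp.symm.mono_left (hx.isSingularSubspace W hW).subset_perp).inter_eq

theorem exists_isFrameMap_of_maximal (h : X.IsWeakPolarSpace n) (hx : X.IsConfiguration n k x)
    (hk : k + 1 = n) :
    ∃ p : Fin n × Bool → P, X.IsFrameMap p ∧ ∀ S, IsFace (k + 1) S → ∀ i ∈ S, p i ∈ x S := by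
  subst hk
  obtain ⟨p, hp, hpx⟩ := hx.isHypercube.exists_isFrameMap h
  exact ⟨p, hp, fun S hS i hi => hpx i S hS hi⟩

theorem exists_isFrameMap_of_points (h : X.IsWeakPolarSpace n) (hx : X.IsConfiguration n 0 x) :
    ∃ p : Fin n × Bool → P, X.IsFrameMap p ∧ ∀ S, IsFace (0 + 1) S → ∀ i ∈ S, p i ∈ x S := by
  have hface : ∀ i : Fin n × Bool, IsFace (0 + 1) {i} := IsFace.singleton
  have hsingleton (i : Fin n × Bool) : ∃ q, x {i} = {q} := by
    obtain ⟨q, hq⟩ := h.nonempty_of_rk_pos (by rw [hx.rk_eq _ (hface i)]; exact one_pos)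
    exact ⟨q, Set.eq_singleton_iff_unique_mem.mpr ⟨hq, fun r hr => h.eq_of_mem_of_rk_le_one
      (hx.isSingularSubspace _ (hface i)) (hx.rk_eq _ (hface i)).le hr hq⟩⟩
  choose p hp using hsingleton
  refine ⟨p, fun i j => ?_, fun S hS i hi => ?_⟩
  · have hopp := hx.opposite_iff _ _ (hface i) (hface j)
    rw [Opposite, hp, hp, Set.disjoint_singleton_left, mem_perp_singleton, opp,
      Finset.image_singleton, Finset.singleton_inj] at hopp
    rw [← not_iff_not, not_not, ← hopp]
    exact not_congr ⟨Collinear.symm, Collinear.symm⟩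
  · obtain ⟨j, rfl⟩ := Finset.card_eq_one.mp hS.card_eq
    rw [Finset.mem_singleton.mp hi, hp]
    exact Set.mem_singleton _

end IsConfiguration

end

/-! ### Tops and stars -/

section

variable {P : Type*} {n k : ℕ} {a b c d e : Fin n × Bool} {R S T W : Finset (Fin n × Bool)}

/-- `insert c R`, `insert d R` and `insert e R` are three faces with `k + 1` vertices that lie in a
common face with `k + 3` vertices; distinctness follows from the cardinalities. -/
structure IsTriple (k : ℕ) (R : Finset (Fin n × Bool)) (c d e : Fin n × Bool) : Prop where
  isFace : IsFace (k + 3) (insert c (insert d (insert e R)))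
  card_eq : R.card = k

namespace IsTriple

variable (hR : IsTriple k R c d e)
include hR

theorem swap_left : IsTriple k R d c e :=
  ⟨Finset.insert_comm c d _ ▸ hR.isFace, hR.card_eq⟩

theorem swap_right : IsTriple k R c e d :=
  ⟨Finset.insert_comm d e R ▸ hR.isFace, hR.card_eq⟩

theorem rotate : IsTriple k R d e c := hR.swap_left.swap_right

theorem notMem_insert : c ∉ insert d (insert e R) := by
  intro hc
  have hcard := hR.isFace.card_eq
  rw [Finset.insert_eq_of_mem hc] at hcard
  have := (Finset.card_insert_le d (insert e R)).trans
    (Nat.succ_le_succ (Finset.card_insert_le e R))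
  have := hR.card_eq
  lia

theorem notMem : c ∉ R := fun hc =>
  hR.notMem_insert (Finset.mem_insert_of_mem (Finset.mem_insert_of_mem hc))

theorem notMem_pair : c ∉ insert d R := fun hc =>
  hR.notMem_insert (Finset.insert_subset_insert d (Finset.subset_insert e R) hc)

theorem isFace_pair : IsFace (k + 2) (insert c (insert d R)) :=
  hR.rotate.rotate.isFace.of_insert hR.rotate.rotate.notMem_insert

theorem isFace_insert : IsFace (k + 1) (insert c R) :=
  hR.swap_left.isFace_pair.of_insert fun hd =>
    hR.swap_left.notMem_insert (Finset.insert_subset_insert c (Finset.subset_insert e R) hd)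

theorem insert_ne : insert c R ≠ insert d R := by
  intro hcd
  have hc : c ∈ insert d R := hcd ▸ Finset.mem_insert_self c R
  exact hR.notMem_insert (Finset.insert_subset_insert d (Finset.subset_insert e R) hc)

theorem exchange {g : Fin n × Bool} (hg : g ∉ insert c (insert d (insert e R)))
    (hg' : antipode g ∉ insert c (insert d (insert e R))) : IsTriple k R c d g := by
  have hsub : insert c (insert d R) ⊆ insert c (insert d (insert e R)) :=
    Finset.insert_subset_insert c (Finset.insert_subset_insert d (Finset.subset_insert e R))
  have hF := hR.isFace_pair.insert (fun h => hg (hsub h)) fun h => hg' (hsub h)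
  exact (⟨hF, hR.card_eq⟩ : IsTriple k R g c d).rotate

end IsTriple

theorem isTriple_erase (ha : a ∈ S) (hc : c ∉ S) (hd : d ∉ S) (hcd : c ≠ d)
    (hF : IsFace (k + 3) (insert c (insert d S))) : IsTriple k (S.erase a) a c d := by
  have hcard := hF.card_eq
  rw [Finset.card_insert_of_notMem (by simp [hcd, hc]), Finset.card_insert_of_notMem hd,
    ← Finset.card_erase_add_one ha] at hcard
  refine ⟨?_, by lia⟩
  rwa [Finset.insert_comm a c, Finset.insert_comm a d, Finset.insert_erase ha]

theorem forall_mem_insert_erase_iff {p : Fin n × Bool → Finset (Fin n × Bool) → Prop}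
    (hc : c ∉ S) : (∀ b ∈ insert c S, p b ((insert c S).erase b)) ↔
      p c S ∧ ∀ b ∈ S, p b (insert c (S.erase b)) := by
  rw [Finset.forall_mem_insert, Finset.erase_insert hc]
  refine and_congr_right fun _ => forall₂_congr fun b hb => ?_
  rw [Finset.erase_insert_of_ne (ne_of_mem_of_not_mem hb hc).symm]

theorem erase_ne_erase (ha : a ∈ W) (hab : a ≠ b) : W.erase a ≠ W.erase b := fun hW =>
  Finset.notMem_erase a W (hW ▸ Finset.mem_erase.mpr ⟨hab, ha⟩)

variable {X : PartialLinearSpace P} {K U V : Set P} {x : Finset (Fin n × Bool) → Set P}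

/-- The family `x` maps the facets of `W` into a top, the singular subspaces of rank `k + 1`
contained in a given one of rank `k + 2`. -/
def IsTop (X : PartialLinearSpace P) (k : ℕ) (x : Finset (Fin n × Bool) → Set P)
    (W : Finset (Fin n × Bool)) : Prop :=
  ∃ U, X.IsSingularSubspace U ∧ X.rk U = k + 2 ∧ ∀ a ∈ W, x (W.erase a) ⊆ U

/-- The family `x` maps the facets of `W` into a star, the singular subspaces of rank `k + 1`
containing a given one of rank `k`. -/
def IsStar (X : PartialLinearSpace P) (k : ℕ) (x : Finset (Fin n × Bool) → Set P)
    (W : Finset (Fin n × Bool)) : Prop :=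
  ∃ K, X.IsSingularSubspace K ∧ X.rk K = k ∧ ∀ a ∈ W, K ⊆ x (W.erase a)

/-- The family `x` maps the three faces of a triple, which all contain `R`, into a top. -/
def IsTripleTop (X : PartialLinearSpace P) (k : ℕ) (x : Finset (Fin n × Bool) → Set P)
    (R : Finset (Fin n × Bool)) (c d e : Fin n × Bool) : Prop :=
  ∃ U, X.IsSingularSubspace U ∧ X.rk U = k + 2 ∧ x (insert c R) ⊆ U ∧ x (insert d R) ⊆ U ∧
    x (insert e R) ⊆ U

namespace IsConfiguration

section

variable (hx : X.IsConfiguration n k x)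
include hx

theorem notMem_perp_opp (hS : IsFace (k + 1) S) {v : P} (hv : v ∈ x (opp S)) :
    v ∉ X.perp (x S) :=
  Set.disjoint_left.mp ((hx.opposite_iff S (opp S) hS hS.opp).mpr rfl) hv

theorem notMem_perp (hS : IsFace (k + 1) S) {v : P} (hv : v ∈ x S) : v ∉ X.perp (x (opp S)) :=
  hx.notMem_perp_opp hS.opp ((opp_opp S).symm ▸ hv)

theorem exists_mem_perp_opp (hS : IsFace (k + 1) S) (hT : IsFace (k + 1) T) (hTS : T ≠ S) :
    ∃ z ∈ x T, z ∈ X.perp (x (opp S)) := by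
  have hopp := (hx.opposite_iff (opp S) T hS.opp hT).not.mpr (by rwa [opp_opp])
  exact Set.not_disjoint_iff.mp hopp

theorem not_subset (hS : IsFace (k + 1) S) (hT : IsFace (k + 1) T) (hST : S ≠ T) :
    ¬ x S ⊆ x T := by
  intro hsub
  obtain ⟨z, hzS, hz⟩ := hx.exists_mem_perp_opp hT hS hST
  exact hx.notMem_perp hT (hsub hzS) hz

theorem joint_erase (hW : IsFace (k + 2) W) (ha : a ∈ W) (hb : b ∈ W) :
    X.Joint (k + 2) (x (W.erase a)) (x (W.erase b)) :=
  (hx.joint_iff _ _ (hW.erase ha) (hW.erase hb)).mpr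
    ⟨W, hW, Finset.erase_subset a W, Finset.erase_subset b W⟩

theorem joint_of_isTriple (hR : IsTriple k R c d e) :
    X.Joint (k + 2) (x (insert c R)) (x (insert d R)) :=
  (hx.joint_iff _ _ hR.isFace_insert hR.swap_left.isFace_insert).mpr ⟨_, hR.isFace_pair,
    Finset.insert_subset_insert c (Finset.subset_insert d R), Finset.subset_insert c _⟩

end

variable (h : X.IsWeakPolarSpace n) (hx : X.IsConfiguration n k x)
include h hx

theorem rk_inter (hS : IsFace (k + 1) S) (hT : IsFace (k + 1) T) (hST : S ≠ T)
    (hJ : X.Joint (k + 2) (x S) (x T)) : X.rk (x S ∩ x T) = k := by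
  have hsS := hx.isSingularSubspace S hS
  have hsT := hx.isSingularSubspace T hT
  have hle := h.rk_le_rk_inter_of_joint hsS hsT (by rw [hx.rk_eq T hT]) hJ
  have hlt := h.rk_lt (hsS.inter hsT.1) hsS
    ⟨Set.inter_subset_left, fun hsub => hx.not_subset hS hT hST fun v hv => (hsub hv).2⟩
  rw [hx.rk_eq S hS] at hle hlt
  lia

theorem eq_of_subset (hS : IsFace (k + 1) S) (hT : IsFace (k + 1) T) (hST : S ≠ T)
    (hU : X.IsSingularSubspace U) (hrU : X.rk U = k + 2) (hSU : x S ⊆ U) (hTU : x T ⊆ U)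
    (hV : X.IsSingularSubspace V) (hrV : X.rk V = k + 2) (hSV : x S ⊆ V) (hTV : x T ⊆ V) :
    U = V := by
  obtain ⟨q, hqT, hqS⟩ := Set.not_subset.mp (hx.not_subset hT hS hST.symm)
  have hsS := hx.isSingularSubspace S hS
  have hrS := hx.rk_eq S hS
  rw [h.eq_span_insert hsS hU hSU (by lia) (hTU hqT) hqS,
    h.eq_span_insert hsS hV hSV (by lia) (hTV hqT) hqS]

theorem exists_separating (hK : X.IsSingularSubspace K) (hrK : X.rk K = k)
    (hS : IsFace (k + 1) S) (hKS : K ⊆ x S) :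
    ∃ v ∈ X.perp K, v ∉ X.perp (x S) ∧
      ∀ T, IsFace (k + 1) T → T ≠ S → K ⊆ x T → v ∈ X.perp (x T) := by
  obtain ⟨v, hv, hvK⟩ := h.exists_mem_inter_perp (hx.isSingularSubspace _ hS.opp) hK
    (by rw [hx.rk_eq _ hS.opp, hrK]; lia)
  refine ⟨v, hvK, hx.notMem_perp_opp hS hv, fun T hT hTS hKT => ?_⟩
  obtain ⟨z, hzT, hz⟩ := hx.exists_mem_perp_opp hS hT hTS
  rw [h.eq_span_insert hK (hx.isSingularSubspace T hT) hKT (by rw [hx.rk_eq T hT, hrK]) hzT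
    fun hzK => hx.notMem_perp hS (hKS hzK) hz, h.perp_span, mem_perp_insert]
  exact ⟨(hz v hv).symm, hvK⟩

/-- No line of the Grassmannian contains three vertices: the subspaces of rank `k + 1` between `K`
and `U` form a line. -/
theorem not_line (hK : X.IsSingularSubspace K) (hrK : X.rk K = k) (hU : X.IsSingularSubspace U)
    (hrU : X.rk U = k + 2) (hR : IsFace (k + 1) R) (hS : IsFace (k + 1) S)
    (hT : IsFace (k + 1) T) (hRS : R ≠ S) (hRT : R ≠ T) (hST : S ≠ T) (hKR : K ⊆ x R)
    (hKS : K ⊆ x S) (hKT : K ⊆ x T) (hRU : x R ⊆ U) (hSU : x S ⊆ U) : ¬ x T ⊆ U := by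
  intro hTU
  obtain ⟨v, -, hvR, hv⟩ := hx.exists_separating h hK hrK hR hKR
  obtain ⟨q, hqT, hqS⟩ := Set.not_subset.mp (hx.not_subset hT hS hST.symm)
  refine hvR (perp_anti hRU ?_)
  rw [h.eq_span_insert (hx.isSingularSubspace S hS) hU hSU (by rw [hx.rk_eq S hS, hrU])
    (hTU hqT) hqS, h.perp_span, mem_perp_insert]
  exact ⟨hv T hT hRT.symm hKT q hqT, hv S hS hRS.symm hKS⟩

theorem subset_or_inter_subset (hR : IsFace (k + 1) R) (hS : IsFace (k + 1) S)
    (hT : IsFace (k + 1) T) (hRS : R ≠ S) (hJRS : X.Joint (k + 2) (x R) (x S))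
    (hJRT : X.Joint (k + 2) (x R) (x T)) (hJST : X.Joint (k + 2) (x S) (x T))
    (hU : X.IsSubspace U) (hRU : x R ⊆ U) (hSU : x S ⊆ U) : x T ⊆ U ∨ x R ∩ x S ⊆ x T := by
  have hsR := hx.isSingularSubspace R hR
  have hsS := hx.isSingularSubspace S hS
  have hsT := hx.isSingularSubspace T hT
  have hrT := hx.rk_eq T hT
  refine h.subset_or_inter_subset hsR hsS hsT hU hRU hSU ?_ ?_
  · have hle := h.rk_le_rk_inter_of_joint hsR hsT (by lia) hJRT
    rw [hx.rk_eq R hR] at hle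
    rw [hx.rk_inter h hR hS hRS hJRS]
    lia
  · have hle := h.rk_le_rk_inter_of_joint hsS hsT (by lia) hJST
    rw [hx.rk_eq S hS] at hle
    lia

theorem isTop_or_isStar (hW : IsFace (k + 2) W) : IsTop X k x W ∨ IsStar X k x W := by
  obtain ⟨a, ha, b, hb, hab⟩ := Finset.one_lt_card.mp (by rw [hW.card_eq]; lia : 1 < W.card)
  obtain ⟨U, hU, hrU, haU, hbU⟩ := hx.joint_erase hW ha hb
  by_cases htop : ∀ c ∈ W, x (W.erase c) ⊆ U
  · exact Or.inl ⟨U, hU, hrU, htop⟩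
  push Not at htop
  obtain ⟨c, hc, hcU⟩ := htop
  have hac : a ≠ c := fun hac => hcU (hac ▸ haU)
  have hsub {a b d : Fin n × Bool} (ha : a ∈ W) (hb : b ∈ W) (hd : d ∈ W) (hab : a ≠ b)
      {U : Set P} (hU : X.IsSubspace U) (haU : x (W.erase a) ⊆ U) (hbU : x (W.erase b) ⊆ U) :
      x (W.erase d) ⊆ U ∨ x (W.erase a) ∩ x (W.erase b) ⊆ x (W.erase d) :=
    hx.subset_or_inter_subset h (hW.erase ha) (hW.erase hb) (hW.erase hd) (erase_ne_erase ha hab)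
      (hx.joint_erase hW ha hb) (hx.joint_erase hW ha hd) (hx.joint_erase hW hb hd) hU haU hbU
  have hrk {b : Fin n × Bool} (hb : b ∈ W) (hab : a ≠ b) :
      X.rk (x (W.erase a) ∩ x (W.erase b)) = k :=
    hx.rk_inter h (hW.erase ha) (hW.erase hb) (erase_ne_erase ha hab) (hx.joint_erase hW ha hb)
  have hs {b : Fin n × Bool} (hb : b ∈ W) :=
    (hx.isSingularSubspace _ (hW.erase ha)).inter (hx.isSingularSubspace _ (hW.erase hb)).1
  have hKc := (hsub ha hb hc hab hU.1 haU hbU).resolve_left hcU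
  have hK := h.eq_of_subset (hs hb) (hs hc) (Set.subset_inter Set.inter_subset_left hKc)
    (by rw [hrk hb hab, hrk hc hac])
  refine Or.inr ⟨_, hs hb, hrk hb hab, fun d hd => by_contra fun hKd => ?_⟩
  have hda : d ≠ a := fun hda => hKd (hda ▸ Set.inter_subset_left)
  obtain ⟨V, hV, hrV, haV, hcV⟩ := hx.joint_erase hW ha hc
  have hdU := (hsub ha hb hd hab hU.1 haU hbU).resolve_right hKd
  have hdV := (hsub ha hc hd hac hV.1 haV hcV).resolve_right (hK ▸ hKd)
  have hUV := hx.eq_of_subset h (hW.erase ha) (hW.erase hd) (erase_ne_erase hd hda).symm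
    hU hrU haU hdU hV hrV haV hdV
  exact hcU (hUV ▸ hcV)

theorem exists_separated (hK : X.IsSingularSubspace K) (hrK : X.rk K = k)
    (hW : IsFace (k + 2) W) (hKW : ∀ a ∈ W, K ⊆ x (W.erase a)) :
    ∃ y : Fin n × Bool → P, ∀ a ∈ W,
      y a ∈ x (W.erase a) ∧ y a ∉ X.span (K ∪ y '' (W.erase a)) := by
  have hpt (a : Fin n × Bool) : ∃ v y : P, a ∈ W → v ∈ X.perp K ∧ y ∈ x (W.erase a) ∧
      ¬ X.Collinear v y ∧ ∀ b ∈ W, b ≠ a → v ∈ X.perp (x (W.erase b)) := by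
    by_cases ha : a ∈ W
    · obtain ⟨v, hvK, hva, hv⟩ := hx.exists_separating h hK hrK (hW.erase ha) (hKW a ha)
      obtain ⟨y, hy, hvy⟩ : ∃ y ∈ x (W.erase a), ¬ X.Collinear v y := by
        simpa only [perp, Set.mem_ofPred_eq, not_forall, exists_prop] using hva
      exact ⟨v, y, fun _ => ⟨hvK, hy, hvy, fun b hb hba =>
        hv _ (hW.erase hb) (erase_ne_erase hb hba) (hKW b hb)⟩⟩
    · obtain ⟨v⟩ := X.nonempty
      exact ⟨v, v, fun ha' => absurd ha' ha⟩
  choose v y hvy using hpt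
  refine ⟨y, fun a ha => ⟨(hvy a ha).2.1, fun hya => (hvy a ha).2.2.1 ?_⟩⟩
  have hsub : K ∪ y '' (W.erase a) ⊆ X.perp {v a} := by
    rw [Set.union_subset_iff, subset_perp_singleton]
    refine ⟨(hvy a ha).1, ?_⟩
    rintro _ ⟨b, hb, rfl⟩
    obtain ⟨hba, hbW⟩ := Finset.mem_erase.mp hb
    exact mem_perp_singleton.mpr
      ((hvy a ha).2.2.2 b hbW hba (y b) (hvy b hbW).2.1).symm
  exact (mem_perp_singleton.mp (h.span_subset_perp hsub hya)).symm

theorem le_of_isStar (hW : IsFace (k + 2) W) (hs : IsStar X k x W) : 2 * k + 2 ≤ n := by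
  obtain ⟨K, hK, hrK, hKW⟩ := hs
  obtain ⟨y, hy⟩ := hx.exists_separated h hK hrK hW hKW
  obtain ⟨c, hc⟩ : W.Nonempty := Finset.card_pos.mp (by rw [hW.card_eq]; lia)
  have hmem : ∀ p ∈ K ∪ y '' W, ∃ a ∈ W, p ∈ x (W.erase a) := by
    rintro p (hp | ⟨a, ha, rfl⟩)
    exacts [⟨c, hc, hKW c hc hp⟩, ⟨a, ha, (hy a ha).1⟩]
  have hcol : K ∪ y '' W ⊆ X.perp (K ∪ y '' W) := by
    intro p hp q hq
    obtain ⟨a, ha, hpa⟩ := hmem p hp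
    obtain ⟨b, hb, hqb⟩ := hmem q hq
    obtain ⟨U, hU, -, haU, hbU⟩ := hx.joint_erase hW ha hb
    exact hU.2 p (haU hpa) q (hbU hqb)
  have hrk := h.rk_span_union_image hK hcol fun a ha => (hy a ha).2
  have hle := h.rk_le (h.isSingularSubspace_span hcol)
  rw [hrk, hrK, hW.card_eq] at hle
  lia

theorem subset_or_inter_subset_of_isTriple (hR : IsTriple k R c d e) (hU : X.IsSubspace U)
    (hcU : x (insert c R) ⊆ U) (hdU : x (insert d R) ⊆ U) :
    x (insert e R) ⊆ U ∨ x (insert c R) ∩ x (insert d R) ⊆ x (insert e R) :=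
  hx.subset_or_inter_subset h hR.isFace_insert hR.rotate.isFace_insert
    hR.rotate.rotate.isFace_insert hR.insert_ne (hx.joint_of_isTriple hR)
    (hx.joint_of_isTriple hR.swap_right) (hx.joint_of_isTriple hR.rotate) hU hcU hdU

theorem rk_inter_of_isTriple (hR : IsTriple k R c d e) :
    X.rk (x (insert c R) ∩ x (insert d R)) = k :=
  hx.rk_inter h hR.isFace_insert hR.rotate.isFace_insert hR.insert_ne (hx.joint_of_isTriple hR)

theorem inter_subset_swap (hR : IsTriple k R c d e)
    (hsub : x (insert c R) ∩ x (insert d R) ⊆ x (insert e R)) :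
    x (insert c R) ∩ x (insert e R) ⊆ x (insert d R) := by
  have hc := hx.isSingularSubspace _ hR.isFace_insert
  have hd := hx.isSingularSubspace _ hR.rotate.isFace_insert
  have he := hx.isSingularSubspace _ hR.rotate.rotate.isFace_insert
  have heq := h.eq_of_subset (hc.inter hd.1) (hc.inter he.1)
    (Set.subset_inter Set.inter_subset_left hsub)
    (by rw [hx.rk_inter_of_isTriple h hR, hx.rk_inter_of_isTriple h hR.swap_right])
  exact heq ▸ Set.inter_subset_right

theorem inter_subset_of_not_isTripleTop (hR : IsTriple k R c d e)
    (ht : ¬ IsTripleTop X k x R c d e) :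
    x (insert c R) ∩ x (insert d R) ⊆ x (insert e R) := by
  obtain ⟨U, hU, hrU, hcU, hdU⟩ := hx.joint_of_isTriple hR
  exact (hx.subset_or_inter_subset_of_isTriple h hR hU.1 hcU hdU).resolve_left
    fun heU => ht ⟨U, hU, hrU, hcU, hdU, heU⟩

theorem not_isTripleTop_of_isTop (hk : 1 ≤ k) (hR : IsTriple k R c d e)
    (ht : IsTop X k x (insert c (insert d R))) : ¬ IsTripleTop X k x R c d e := by
  rintro ⟨V, hV, hrV, hcV, hdV, heV⟩
  obtain ⟨U, hU, hrU, hUW⟩ := ht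
  have hdU := hUW c (Finset.mem_insert_self c _)
  have hcU := hUW d (Finset.mem_insert_of_mem (Finset.mem_insert_self d R))
  rw [Finset.erase_insert hR.notMem_pair] at hdU
  rw [Finset.insert_comm, Finset.erase_insert hR.swap_left.notMem_pair] at hcU
  obtain rfl : U = V := hx.eq_of_subset h hR.isFace_insert hR.rotate.isFace_insert hR.insert_ne
    hU hrU hcU hdU hV hrV hcV hdV
  obtain ⟨r, hr⟩ := Finset.card_pos.mp (hR.card_eq ▸ hk)
  have hrW : r ∈ insert c (insert d R) := by simp [hr]
  obtain ⟨Z, hZ, hrZ, heZ⟩ := (hx.joint_iff _ _ (hR.isFace_pair.erase hrW)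
    hR.rotate.rotate.isFace_insert).mp ⟨U, hU, hrU, hUW r hrW, heV⟩
  have hsub : insert c (insert d (insert e R)) ⊆ Z := by
    have := hR.notMem
    have := hR.rotate.notMem
    grind
  have := Finset.card_le_card hsub
  rw [hR.isFace.card_eq, hZ.card_eq] at this
  lia

theorem subset_of_isTripleTop {g : Fin n × Bool} (hR : IsTriple k R c d e)
    (hU : X.IsSingularSubspace U) (hrU : X.rk U = k + 2) (hcU : x (insert c R) ⊆ U)
    (hdU : x (insert d R) ⊆ U) (heU : x (insert e R) ⊆ U)
    (hg : g ∉ insert c (insert d (insert e R)))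
    (hg' : antipode g ∉ insert c (insert d (insert e R))) : x (insert g R) ⊆ U := by
  have hcdg := hR.exchange hg hg'
  have hceg : IsTriple k R c e g := by
    rw [Finset.insert_comm d e] at hg hg'
    exact hR.swap_right.exchange hg hg'
  by_contra hgU
  have hd := hx.inter_subset_swap h hcdg
    ((hx.subset_or_inter_subset_of_isTriple h hcdg hU.1 hcU hdU).resolve_left hgU)
  have he := hx.inter_subset_swap h hceg
    ((hx.subset_or_inter_subset_of_isTriple h hceg hU.1 hcU heU).resolve_left hgU)
  exact hx.not_line h ((hx.isSingularSubspace _ hR.isFace_insert).inter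
    (hx.isSingularSubspace _ hcdg.rotate.rotate.isFace_insert).1)
    (hx.rk_inter_of_isTriple h hcdg.swap_right) hU hrU hR.isFace_insert hR.rotate.isFace_insert
    hR.rotate.rotate.isFace_insert hR.insert_ne hR.swap_right.insert_ne hR.rotate.insert_ne
    Set.inter_subset_left hd he hcU hdU heU

theorem not_isTripleTop_of_lt (hk : k + 3 < n) (hR : IsTriple k R c d e) :
    ¬ IsTripleTop X k x R c d e := by
  rintro ⟨U, hU, hrU, hcU, hdU, heU⟩
  obtain ⟨g, hg, hg'⟩ := hR.isFace.exists_notMem hk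
  have hgU := hx.subset_of_isTripleTop h hR hU hrU hcU hdU heU hg hg'
  have hgU' := hx.subset_of_isTripleTop h hR hU hrU hcU hdU heU hg'
    (by rwa [antipode_antipode])
  have hcdg := (hR.exchange hg hg').rotate.rotate
  obtain ⟨Z, hZ, hgZ, hgZ'⟩ := (hx.joint_iff _ _ hcdg.isFace_insert
    (hcdg.isFace_insert.insert_antipode hcdg.notMem)).mp ⟨U, hU, hrU, hgU, hgU'⟩
  exact hZ.antipode_notMem g (hgZ (Finset.mem_insert_self g R))
    (hgZ' (Finset.mem_insert_self _ R))

theorem inter_subset_of_isTop (hk : 1 ≤ k) (hR : IsTriple k R c d e)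
    (ht : IsTop X k x (insert c (insert d R))) :
    x (insert c R) ∩ x (insert d R) ⊆ x (insert e R) :=
  hx.inter_subset_of_not_isTripleTop h hR (hx.not_isTripleTop_of_isTop h hk hR ht)

/-- Otherwise the common subspace of a star would be the same for all `W`, by exchanges; but the
subspaces of opposite faces are disjoint. -/
theorem isTop_of_forall_not_isTripleTop (hk : 1 ≤ k) (hkn : k + 3 ≤ n)
    (hrow : ∀ R c d e, IsTriple k R c d e → ¬ IsTripleTop X k x R c d e)
    (hW : IsFace (k + 2) W) : IsTop X k x W := by
  refine (hx.isTop_or_isStar h hW).resolve_right ?_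
  rintro ⟨K, -, hrK, hKW⟩
  have hopp : ∀ a ∈ opp W, K ⊆ x ((opp W).erase a) := by
    refine IsFace.exchange_induction_of_lt (p := fun W => ∀ a ∈ W, K ⊆ x (W.erase a)) hkn ?_ hW
      hW.opp (Finset.empty_subset _) (Finset.empty_subset _) hKW
    intro S c d _ hc hd hcd hF hp
    rw [forall_mem_insert_erase_iff (p := fun _ T => K ⊆ x T) hc] at hp
    rw [forall_mem_insert_erase_iff (p := fun _ T => K ⊆ x T) hd]
    refine ⟨hp.1, fun a ha => (Set.subset_inter ?_ (hp.2 a ha)).trans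
      (hx.inter_subset_of_not_isTripleTop h (isTriple_erase ha hc hd hcd hF)
        (hrow _ _ _ _ (isTriple_erase ha hc hd hcd hF)))⟩
    rw [Finset.insert_erase ha]
    exact hp.1
  obtain ⟨a, ha⟩ : W.Nonempty := Finset.card_pos.mp (by rw [hW.card_eq]; lia)
  obtain ⟨v, hv⟩ := h.nonempty_of_rk_pos (A := K) (by lia)
  have hva := hopp (antipode a) (mem_opp.mpr (by rwa [antipode_antipode])) hv
  rw [← opp_erase] at hva
  exact hx.notMem_perp_opp (hW.erase ha) hva
    ((hx.isSingularSubspace _ (hW.erase ha)).subset_perp (hKW a ha hv))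

theorem isTop_of_isTop (hk : 1 ≤ k) (hkn : k + 3 ≤ n) (hW : IsFace (k + 2) W)
    (hV : IsFace (k + 2) T) (ht : IsTop X k x W) : IsTop X k x T := by
  refine IsFace.exchange_induction_of_lt (p := IsTop X k x) hkn ?_ hW hV
    (Finset.empty_subset _) (Finset.empty_subset _) ht
  intro S c d _ hc hd hcd hF ht
  have hcS : IsFace (k + 2) (insert c S) := by
    rw [Finset.insert_comm] at hF
    exact hF.of_insert (by simp [hd, hcd.symm])
  have hdS : IsFace (k + 2) (insert d S) := hF.of_insert (by simp [hc, hcd])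
  have hS : IsFace (k + 1) S := hcS.of_insert hc
  refine (hx.isTop_or_isStar h hdS).resolve_right ?_
  rintro ⟨K, hK, hrK, hKW⟩
  obtain ⟨U, hU, hrU, hUW⟩ := id ht
  rw [forall_mem_insert_erase_iff (p := fun _ T => K ⊆ x T) hd] at hKW
  rw [forall_mem_insert_erase_iff (p := fun _ T => x T ⊆ U) hc] at hUW
  have hR {a : Fin n × Bool} (ha : a ∈ S) := isTriple_erase ha hc hd hcd hF
  have hKc {a : Fin n × Bool} (ha : a ∈ S) : K ⊆ x (insert c (S.erase a)) := by
    have hsub := hx.inter_subset_swap h (hR ha) (hx.inter_subset_of_isTop h hk (hR ha)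
      (by rwa [Finset.insert_comm, Finset.insert_erase ha]))
    rw [Finset.insert_erase ha] at hsub
    exact (Set.subset_inter hKW.1 (hKW.2 a ha)).trans hsub
  have hne (a : Fin n × Bool) : S ≠ insert c (S.erase a) := fun heq =>
    hc (heq ▸ Finset.mem_insert_self c _)
  obtain ⟨a, ha, b, hb, hab⟩ := Finset.one_lt_card.mp (by rw [hS.card_eq]; lia : 1 < S.card)
  refine hx.not_line h hK hrK hU hrU hS (hR ha).rotate.isFace_insert
    (hR hb).rotate.isFace_insert (hne a) (hne b) ?_ hKW.1 (hKc ha) (hKc hb) hUW.1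
    (hUW.2 a ha) (hUW.2 b hb)
  rw [← Finset.erase_insert_of_ne (ne_of_mem_of_not_mem ha hc).symm,
    ← Finset.erase_insert_of_ne (ne_of_mem_of_not_mem hb hc).symm]
  exact erase_ne_erase (Finset.mem_insert_of_mem ha) hab

theorem exists_inter_perp_opp_eq_singleton (hW : IsFace (k + 2) W) (hU : X.IsSingularSubspace U)
    (hrU : X.rk U = k + 2) (hUW : ∀ a ∈ W, x (W.erase a) ⊆ U) (ha : a ∈ W) :
    ∃ q, U ∩ X.perp (x (opp (W.erase a))) = {q} ∧ ∀ b ∈ W, q ∈ x (W.erase b) ↔ b ≠ a := by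
  have hS := hW.erase ha
  have hE := hU.inter (h.isSubspace_perp (x (opp (W.erase a))))
  have hrk := h.rk_le_rk_inter hE (hx.isSingularSubspace _ hS) hU Set.inter_subset_left (hUW a ha)
    (by rw [hrU, hx.rk_eq _ hS])
  have hempty : U ∩ X.perp (x (opp (W.erase a))) ∩ x (W.erase a) = ∅ :=
    Set.eq_empty_of_forall_notMem fun v hv => hx.notMem_perp hS hv.2 hv.1.2
  rw [hempty, h.rk_empty] at hrk
  obtain ⟨q, hq⟩ := h.exists_mem_inter_perp hU (hx.isSingularSubspace _ hS.opp)
    (by rw [hx.rk_eq _ hS.opp, hrU]; lia)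
  have huniq {r} (hr : r ∈ U ∩ X.perp (x (opp (W.erase a)))) : r = q :=
    h.eq_of_mem_of_rk_le_one hE hrk hr hq
  refine ⟨q, Set.eq_singleton_iff_unique_mem.mpr ⟨hq, fun r hr => huniq hr⟩, fun b hb =>
    ⟨?_, fun hba => ?_⟩⟩
  · rintro hqb rfl
    exact hx.notMem_perp hS hqb hq.2
  · obtain ⟨z, hz, hzp⟩ := hx.exists_mem_perp_opp hS (hW.erase hb) (erase_ne_erase hb hba)
    exact huniq ⟨hUW b hb hz, hzp⟩ ▸ hz

end IsConfiguration

end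

/-! ### Frames from tops -/

section

variable {P : Type*} {X : PartialLinearSpace P} {n k : ℕ} {S W : Finset (Fin n × Bool)}
  {x : Finset (Fin n × Bool) → Set P} {p : Fin n × Bool → P}

theorem mem_of_mem_erase_iff (hkn : k + 1 < n)
    (hp : ∀ a W, IsFace (k + 2) W → a ∈ W → ∀ b ∈ W, p a ∈ x (W.erase b) ↔ b ≠ a)
    (hS : IsFace (k + 1) S) (hi : i ∈ S) : p i ∈ x S := by
  obtain ⟨c, hc, hc'⟩ := hS.exists_notMem hkn
  have hpi := hp i _ (hS.insert hc hc') (Finset.mem_insert_of_mem hi) c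
    (Finset.mem_insert_self c S)
  rw [Finset.erase_insert hc] at hpi
  exact hpi.mpr (ne_of_mem_of_not_mem hi hc).symm

namespace IsConfiguration

variable (h : X.IsWeakPolarSpace n) (hx : X.IsConfiguration n k x)
include h hx

theorem isHypercube_of_isTop {u : Finset (Fin n × Bool) → Set P} (hkn : k + 2 = n)
    (hu : ∀ W, IsFace (k + 2) W → X.IsSingularSubspace (u W) ∧ X.rk (u W) = k + 2 ∧
      ∀ a ∈ W, x (W.erase a) ⊆ u W) : X.IsHypercube u := by
  subst hkn
  refine ⟨fun W hW => (hu W hW).1, fun W hW => (hu W hW).2.1, fun W hW c hc => ?_, fun W hW => ?_⟩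
  · have hV := hW.insert_antipode_erase hc
    have hsub := (hu _ hV).2.2 _ (Finset.mem_insert_self _ _)
    rw [Finset.erase_insert fun hc' =>
      hW.antipode_notMem c hc (Finset.mem_of_mem_erase hc')] at hsub
    rw [Nat.succ_le_succ_iff, ← hx.rk_eq _ (hW.erase hc)]
    exact h.rk_mono (hx.isSingularSubspace _ (hW.erase hc)) ((hu W hW).1.inter (hu _ hV).1.1)
      (Set.subset_inter ((hu W hW).2.2 c hc) hsub)
  · refine Set.eq_empty_of_forall_notMem fun z hz => ?_
    have hperp {a} (ha : a ∈ W) : z ∈ u W ∩ X.perp (x (opp (W.erase a))) := by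
      refine ⟨hz.1, (hu _ hW.opp).1.mem_perp hz.2 ?_⟩
      rw [opp_erase]
      exact (hu _ hW.opp).2.2 _ (mem_opp.mpr ((antipode_antipode a).symm ▸ ha))
    obtain ⟨a, ha, b, hb, hab⟩ :=
      Finset.one_lt_card.mp (by rw [hW.card_eq]; lia : 1 < W.card)
    obtain ⟨hU, hrU, hUW⟩ := hu W hW
    obtain ⟨q, hq, hqx⟩ := hx.exists_inter_perp_opp_eq_singleton h hW hU hrU hUW ha
    obtain ⟨r, hr, hrx⟩ := hx.exists_inter_perp_opp_eq_singleton h hW hU hrU hUW hb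
    have hzq : z = q := hq.subset (hperp ha)
    have hzr : z = r := hr.subset (hperp hb)
    exact (hrx b hb).mp (hzr ▸ hzq ▸ (hqx b hb).mpr hab.symm) rfl

theorem exists_isFrameMap_of_isTop_of_eq (hkn : k + 2 = n)
    (ht : ∀ W, IsFace (k + 2) W → IsTop X k x W) :
    ∃ p : Fin n × Bool → P, X.IsFrameMap p ∧ ∀ S, IsFace (k + 1) S → ∀ i ∈ S, p i ∈ x S := by
  subst hkn
  choose! u hu using ht
  have hcube := hx.isHypercube_of_isTop h rfl hu
  obtain ⟨p, hp, hpu⟩ := hcube.exists_isFrameMap h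
  refine ⟨p, hp, fun S hS i hi => ?_⟩
  have hsub {c} (hc : c ∉ S) (hF : IsFace (k + 2) (insert c S)) : x S ⊆ u (insert c S) := by
    simpa only [Finset.erase_insert hc] using (hu _ hF).2.2 c (Finset.mem_insert_self c S)
  obtain ⟨c, hc, hc'⟩ := hS.exists_notMem (by lia)
  have hW := hS.insert hc hc'
  have hV := hW.insert_antipode hc
  have hI := (hu _ hW).1.inter (hu _ hV).1.1
  have hlt := h.rk_lt hI (hu _ hW).1 (Set.ssubset_iff_exists.mpr ⟨Set.inter_subset_left, p c,
    hpu _ _ hW (Finset.mem_insert_self c S), fun hpc =>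
      hcube.notMem_of_antipode_mem hpu hV (Finset.mem_insert_self _ S) hpc.2⟩)
  rw [(hu _ hW).2.1] at hlt
  rw [h.eq_of_subset (hx.isSingularSubspace S hS) hI (Set.subset_inter (hsub hc hW) (hsub hc' hV))
    (by rw [hx.rk_eq S hS]; lia)]
  exact ⟨hpu _ _ hW (Finset.mem_insert_of_mem hi), hpu _ _ hV (Finset.mem_insert_of_mem hi)⟩

theorem exists_mem_erase_iff (hk : 1 ≤ k) (hkn : k + 3 ≤ n)
    (ht : ∀ W, IsFace (k + 2) W → IsTop X k x W) (a : Fin n × Bool) :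
    ∃ q, ∀ W, IsFace (k + 2) W → a ∈ W → ∀ b ∈ W, q ∈ x (W.erase b) ↔ b ≠ a := by
  obtain ⟨W, hW, haW⟩ := IsFace.exists_mem a (by lia : 0 < k + 2) (by lia)
  obtain ⟨U, hU, hrU, hUW⟩ := ht W hW
  obtain ⟨q, -, hq⟩ := hx.exists_inter_perp_opp_eq_singleton h hW hU hrU hUW haW
  refine ⟨q, fun V hV haV => IsFace.exchange_induction_of_lt (A := {a})
    (p := fun W => ∀ b ∈ W, q ∈ x (W.erase b) ↔ b ≠ a) hkn ?_ hW hV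
    (Finset.singleton_subset_iff.mpr haW) (Finset.singleton_subset_iff.mpr haV) hq⟩
  intro S c d haS hc hd hcd hF hp
  rw [Finset.singleton_subset_iff] at haS
  rw [forall_mem_insert_erase_iff (p := fun b T => q ∈ x T ↔ b ≠ a) hc] at hp
  rw [forall_mem_insert_erase_iff (p := fun b T => q ∈ x T ↔ b ≠ a) hd]
  have hqS : q ∈ x S := hp.1.mpr (ne_of_mem_of_not_mem haS hc).symm
  refine ⟨iff_of_true hqS (ne_of_mem_of_not_mem haS hd).symm, fun b hb => ?_⟩
  have hR := isTriple_erase hb hc hd hcd hF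
  have hsub := hx.inter_subset_of_isTop h hk hR (ht _ hR.isFace_pair)
  have hsub' := hx.inter_subset_swap h hR hsub
  rw [Finset.insert_erase hb] at hsub hsub'
  rw [← hp.2 b hb]
  exact ⟨fun hqd => hsub' ⟨hqS, hqd⟩, fun hqc => hsub ⟨hqS, hqc⟩⟩

theorem eq_span_of_mem_erase_iff (hkn : k + 1 < n)
    (hp : ∀ a W, IsFace (k + 2) W → a ∈ W → ∀ b ∈ W, p a ∈ x (W.erase b) ↔ b ≠ a)
    (hS : IsFace (k + 1) S) : x S = X.span (p '' S) := by
  obtain ⟨c, hc, hc'⟩ := hS.exists_notMem hkn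
  have hW := hS.insert hc hc'
  have hsS := hx.isSingularSubspace S hS
  have hpS : p '' S ⊆ x S := Set.image_subset_iff.mpr fun i hi =>
    mem_of_mem_erase_iff hkn hp hS hi
  have hcol : p '' S ⊆ X.perp (p '' S) := fun q hq => hsS.mem_perp (hpS hq) hpS
  refine (h.eq_of_subset (h.isSingularSubspace_span hcol) hsS (span_subset hsS.1 hpS) ?_).symm
  rw [hx.rk_eq S hS, h.rk_span_image hcol fun a ha hpa => ?_, hS.card_eq]
  have haW := Finset.mem_insert_of_mem (b := c) ha
  refine (hp a _ hW haW a haW).mp (span_subset (hx.isSingularSubspace _ (hW.erase haW)).1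
    ?_ hpa) rfl
  rintro _ ⟨i, hi, rfl⟩
  obtain ⟨hia, hiS⟩ := Finset.mem_erase.mp hi
  exact (hp i _ hW (Finset.mem_insert_of_mem hiS) a haW).mpr hia.symm

theorem exists_isFrameMap_of_isTop (hk : 1 ≤ k) (hkn : k + 3 ≤ n)
    (ht : ∀ W, IsFace (k + 2) W → IsTop X k x W) :
    ∃ p : Fin n × Bool → P, X.IsFrameMap p ∧ ∀ S, IsFace (k + 1) S → ∀ i ∈ S, p i ∈ x S := by
  choose p hp using hx.exists_mem_erase_iff h hk hkn ht
  have hmem {S} (hS : IsFace (k + 1) S) {i} (hi : i ∈ S) : p i ∈ x S :=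
    mem_of_mem_erase_iff (by lia) hp hS hi
  have hcol {i j} (hij : j ≠ antipode i) : X.Collinear (p i) (p j) := by
    obtain rfl | hne := eq_or_ne i j
    · exact X.collinear_refl _
    obtain ⟨S, hS, hsub⟩ := (IsFace.pair hne hij).exists_superset (k := k + 1) (by lia) (by lia)
    rw [Finset.insert_subset_iff, Finset.singleton_subset_iff] at hsub
    exact (hx.isSingularSubspace S hS).2 _ (hmem hS hsub.1) _ (hmem hS hsub.2)
  refine ⟨p, fun i j => ⟨?_, hcol⟩, fun S hS i hi => hmem hS hi⟩
  rintro hij rfl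
  obtain ⟨S, hS, hiS⟩ := IsFace.exists_mem i (by lia : 0 < k + 1) (by lia)
  refine hx.notMem_perp hS (hmem hS hiS) ?_
  rw [hx.eq_span_of_mem_erase_iff h (by lia) hp hS.opp, h.perp_span]
  rintro _ ⟨j, -, rfl⟩
  obtain rfl | hne := eq_or_ne j (antipode i)
  exacts [hij, hcol hne]

end IsConfiguration

end

/-! ### Reflections of the root system `D₄` -/

section

variable {P : Type*} {n k : ℕ}

section

/-- The edges `S` and `T` of the cross-polytope are equal or span a triangle. -/
def Linked (S T : Finset (Fin n × Bool)) : Prop :=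
  (∃ i ∈ S, i ∈ T) ∧ ∀ i ∈ S, antipode i ∉ T

theorem Linked.symm {S T : Finset (Fin n × Bool)} (h : Linked S T) : Linked T S := by
  obtain ⟨⟨i, hiS, hiT⟩, hST⟩ := h
  exact ⟨⟨i, hiT, hiS⟩, fun j hjT hjS => hST _ hjS ((antipode_antipode j).symm ▸ hjT)⟩

theorem IsFace.linked_iff {S T : Finset (Fin n × Bool)} (hn : 3 ≤ n) (hS : IsFace 2 S)
    (hT : IsFace 2 T) : Linked S T ↔ ∃ W, IsFace 3 W ∧ S ⊆ W ∧ T ⊆ W := by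
  have hcard := Finset.card_union_add_card_inter S T
  rw [hS.card_eq, hT.card_eq] at hcard
  constructor
  · rintro ⟨⟨i, hiS, hiT⟩, hST⟩
    have hF : IsFace (S ∪ T).card (S ∪ T) := by
      refine ⟨fun j hj hj' => ?_, rfl⟩
      rcases Finset.mem_union.mp hj with hj | hj <;> rcases Finset.mem_union.mp hj' with hj' | hj'
      · exact hS.antipode_notMem j hj hj'
      · exact hST j hj hj'
      · exact hST _ hj' ((antipode_antipode j).symm ▸ hj)
      · exact hT.antipode_notMem j hj hj'
    have hinter : 0 < (S ∩ T).card := Finset.card_pos.mpr ⟨i, Finset.mem_inter.mpr ⟨hiS, hiT⟩⟩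
    obtain ⟨W, hW, hsub⟩ := hF.exists_superset (by lia : (S ∪ T).card ≤ 3) hn
    exact ⟨W, hW, Finset.union_subset_iff.mp hsub⟩
  · rintro ⟨W, hW, hSW, hTW⟩
    refine ⟨?_, fun i hiS hiT => hW.antipode_notMem i (hSW hiS) (hTW hiT)⟩
    have hunion := Finset.card_le_card (Finset.union_subset hSW hTW)
    rw [hW.card_eq] at hunion
    obtain ⟨i, hi⟩ : (S ∩ T).Nonempty := Finset.card_pos.mp (by lia)
    exact ⟨i, Finset.mem_inter.mp hi⟩

theorem opp_subset_opp {S T : Finset (Fin n × Bool)} : opp S ⊆ opp T ↔ S ⊆ T :=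
  Finset.image_subset_image_iff antipode_injective

theorem opp_sdiff (S T : Finset (Fin n × Bool)) : opp (S \ T) = opp S \ opp T :=
  Finset.image_sdiff S T antipode_injective

theorem IsFace.not_subset_opp {m l : ℕ} {E S : Finset (Fin n × Bool)} (hE : IsFace m E)
    (hS : IsFace (l + 1) S) (hSE : S ⊆ E) : ¬ S ⊆ opp E := by
  obtain ⟨i, hi⟩ : S.Nonempty := Finset.card_pos.mp (hS.card_eq ▸ l.succ_pos)
  exact fun hSE' => hE.antipode_notMem i (hSE hi) (mem_opp.mp (hSE' hi))

/-- The automorphism of the graph of `Linked` edges of the `4`-dimensional cross-polytope that the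
orthogonal reflection in the vector from the centre to the facet `E` induces. The edges correspond
to the roots of the root system `D₄`, and this reflection does not preserve the cross-polytope. -/
def reflect (E S : Finset (Fin 4 × Bool)) : Finset (Fin 4 × Bool) :=
  if S ⊆ E then opp (E \ S) else if S ⊆ opp E then opp (opp E \ S) else S

variable {E S T : Finset (Fin 4 × Bool)}

theorem reflect_of_subset (hSE : S ⊆ E) : reflect E S = opp (E \ S) := if_pos hSE

theorem reflect_of_not_subset (hSE : ¬ S ⊆ E) (hSE' : ¬ S ⊆ opp E) : reflect E S = S := by
  rw [reflect, if_neg hSE, if_neg hSE']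

theorem reflect_opp_left (hE : IsFace 4 E) (hS : IsFace 2 S) :
    reflect (opp E) S = reflect E S := by
  by_cases hSE : S ⊆ E
  · rw [reflect, if_neg (hE.not_subset_opp hS hSE), opp_opp, if_pos hSE, reflect_of_subset hSE]
  · rw [reflect, reflect, opp_opp, if_neg hSE, if_neg hSE]

theorem reflect_opp (hE : IsFace 4 E) (hS : IsFace 2 S) :
    reflect E (opp S) = opp (reflect E S) := by
  rw [← reflect_opp_left hE hS.opp]
  simp only [reflect, apply_ite opp, opp_subset_opp, opp_sdiff]

theorem isFace_reflect (hE : IsFace 4 E) (hS : IsFace 2 S) : IsFace 2 (reflect E S) := by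
  have of_subset {E} (hE : IsFace 4 E) (hSE : S ⊆ E) : IsFace 2 (reflect E S) := by
    have hF := hE.mono (Finset.sdiff_subset (s := E) (t := S))
    rw [Finset.card_sdiff_of_subset hSE, hE.card_eq, hS.card_eq] at hF
    exact reflect_of_subset hSE ▸ hF.opp
  by_cases hSE : S ⊆ E
  · exact of_subset hE hSE
  by_cases hSE' : S ⊆ opp E
  · exact reflect_opp_left hE hS ▸ of_subset hE.opp hSE'
  · rwa [reflect_of_not_subset hSE hSE']

theorem reflect_reflect (hE : IsFace 4 E) (hS : IsFace 2 S) : reflect E (reflect E S) = S := by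
  have hS' := isFace_reflect hE hS
  have of_subset {E} (hE : IsFace 4 E) (hS' : IsFace 2 (reflect E S)) (hSE : S ⊆ E) :
      reflect E (reflect E S) = S := by
    rw [← reflect_opp_left hE hS', reflect_of_subset hSE,
      reflect_of_subset (opp_subset_opp.mpr Finset.sdiff_subset), ← opp_sdiff, opp_opp,
      Finset.sdiff_sdiff_eq_self hSE]
  by_cases hSE : S ⊆ E
  · exact of_subset hE hS' hSE
  by_cases hSE' : S ⊆ opp E
  · have heq := of_subset hE.opp (isFace_reflect hE.opp hS) hSE'
    rwa [reflect_opp_left hE hS, reflect_opp_left hE hS'] at heq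
  · rw [reflect_of_not_subset hSE hSE', reflect_of_not_subset hSE hSE']

theorem linked_reflect_of_subset_of_subset (hE : IsFace 4 E) (hS : IsFace 2 S) (hT : IsFace 2 T)
    (hSE : S ⊆ E) (hTE : T ⊆ E) (hST : Linked S T) : Linked (reflect E S) (reflect E T) := by
  obtain ⟨⟨i, hiS, hiT⟩, -⟩ := hST
  have hcard := Finset.card_union_add_card_inter S T
  have hinter : 0 < (S ∩ T).card := Finset.card_pos.mpr ⟨i, Finset.mem_inter.mpr ⟨hiS, hiT⟩⟩
  rw [hS.card_eq, hT.card_eq] at hcard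
  obtain ⟨m, hm, hmST⟩ := Finset.exists_mem_notMem_of_card_lt_card
    (by rw [hE.card_eq]; lia : (S ∪ T).card < E.card)
  rw [reflect_of_subset hSE, reflect_of_subset hTE]
  refine ⟨⟨antipode m, ?_⟩, fun j hjS hjT => ?_⟩
  · grind [mem_opp, antipode_antipode]
  · exact hE.opp.antipode_notMem j (by grind [mem_opp]) (by grind [mem_opp])

theorem linked_reflect_of_subset_of_not_subset (hE : IsFace 4 E) (hT : IsFace 2 T)
    (hSE : S ⊆ E) (hTE : ¬ T ⊆ E) (hST : Linked S T) : Linked (reflect E S) T := by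
  obtain ⟨⟨i, hiS, hiT⟩, hST⟩ := hST
  obtain ⟨j, hjT, hjE⟩ := Finset.not_subset.mp hTE
  have hij : i ≠ j := ne_of_mem_of_not_mem (hSE hiS) hjE
  have hpair : {i, j} = T := Finset.eq_of_subset_of_card_le
    (Finset.insert_subset hiT (Finset.singleton_subset_iff.mpr hjT))
    (by rw [hT.card_eq, Finset.card_pair hij])
  have hjE' := (hE.mem_or_antipode_mem j).resolve_left hjE
  rw [reflect_of_subset hSE]
  refine ⟨⟨j, ?_, hjT⟩, ?_⟩ <;> grind [mem_opp, antipode_antipode]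

theorem linked_reflect (hE : IsFace 4 E) (hS : IsFace 2 S) (hT : IsFace 2 T)
    (hST : Linked S T) : Linked (reflect E S) (reflect E T) := by
  have of_subset {E S T} (hE : IsFace 4 E) (hS : IsFace 2 S) (hT : IsFace 2 T) (hSE : S ⊆ E)
      (hST : Linked S T) : Linked (reflect E S) (reflect E T) := by
    by_cases hTE : T ⊆ E
    · exact linked_reflect_of_subset_of_subset hE hS hT hSE hTE hST
    · have hTE' : ¬ T ⊆ opp E := fun hTE' => by
        obtain ⟨i, hiS, hiT⟩ := hST.1
        exact hE.antipode_notMem i (hSE hiS) (mem_opp.mp (hTE' hiT))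
      rw [reflect_of_not_subset hTE hTE']
      exact linked_reflect_of_subset_of_not_subset hE hT hSE hTE hST
  by_cases hSE : S ⊆ E
  · exact of_subset hE hS hT hSE hST
  by_cases hTE : T ⊆ E
  · exact (of_subset hE hT hS hTE hST.symm).symm
  rw [← reflect_opp_left hE hS, ← reflect_opp_left hE hT]
  by_cases hSE' : S ⊆ opp E
  · exact of_subset hE.opp hS hT hSE' hST
  by_cases hTE' : T ⊆ opp E
  · exact (of_subset hE.opp hT hS hTE' hST.symm).symm
  · rwa [reflect_opp_left hE hS, reflect_opp_left hE hT, reflect_of_not_subset hSE hSE',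
      reflect_of_not_subset hTE hTE']

end

namespace IsConfiguration

variable {X : PartialLinearSpace P}

section

variable {E R : Finset (Fin 4 × Bool)} {c d e : Fin 4 × Bool} {x : Finset (Fin 4 × Bool) → Set P}

theorem comp_reflect (hx : X.IsConfiguration 4 1 x) (hE : IsFace 4 E) :
    X.IsConfiguration 4 1 (x ∘ reflect E) where
  isSingularSubspace S hS := hx.isSingularSubspace _ (isFace_reflect hE hS)
  rk_eq S hS := hx.rk_eq _ (isFace_reflect hE hS)
  joint_iff S T hS hT := by
    have hS' := isFace_reflect hE hS
    have hT' := isFace_reflect hE hT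
    rw [Function.comp_apply, Function.comp_apply, hx.joint_iff _ _ hS' hT',
      ← hS'.linked_iff (by norm_num) hT', ← hS.linked_iff (by norm_num) hT]
    refine ⟨fun hST => ?_, linked_reflect hE hS hT⟩
    simpa only [reflect_reflect hE hS, reflect_reflect hE hT] using linked_reflect hE hS' hT' hST
  le_rk_inter hk := absurd hk (by norm_num)
  opposite_iff S T hS hT := by
    rw [Function.comp_apply, Function.comp_apply,
      hx.opposite_iff _ _ (isFace_reflect hE hS) (isFace_reflect hE hT), ← reflect_opp hE hS]
    refine ⟨fun hST => ?_, congrArg _⟩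
    rw [← reflect_reflect hE hT, hST, reflect_reflect hE hS.opp]

/-- A reflection takes three edges with a common vertex to the edges of a triangle. -/
theorem exists_isTop_comp_reflect (hR : IsTriple 1 R c d e) (ht : IsTripleTop X 1 x R c d e) :
    ∃ E W, IsFace 4 E ∧ IsFace 3 W ∧ IsTop X 1 (x ∘ reflect E) W := by
  obtain ⟨U, hU, hrU, hcU, hdU, heU⟩ := ht
  obtain ⟨a, rfl⟩ := Finset.card_eq_one.mp hR.card_eq
  have hc := hR.notMem_insert
  have hd := hR.swap_left.notMem_insert
  have he := hR.rotate.rotate.notMem_insert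
  have hF := hR.isFace
  have hE : IsFace 4 (insert (antipode e) (insert (antipode a) {c, d})) := by
    have hF' : IsFace 4 (insert a (insert e {c, d})) := by convert hF using 1; grind
    have hF'' := hF'.insert_antipode (by grind)
    rw [Finset.insert_comm] at hF''
    have ha := hF'.antipode_notMem a (Finset.mem_insert_self _ _)
    exact hF''.insert_antipode (by grind)
  set E : Finset (Fin 4 × Bool) := insert (antipode e) (insert (antipode a) {c, d})
  have hreflect_cd : reflect E {c, d} = {e, a} := by
    rw [reflect_of_subset (by grind)]
    ext j
    have := hF.antipode_notMem
    grind [mem_opp, antipode_antipode]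
  have hreflect {b} (hb : b ∈ E) (ha : a ∉ E) : reflect E {b, a} = {b, a} :=
    reflect_of_not_subset (by grind) fun hsub =>
      hE.opp.antipode_notMem b (hsub (by simp)) (mem_opp.mpr ((antipode_antipode b).symm ▸ hb))
  have ha : a ∉ E := fun ha => hE.antipode_notMem a ha (by grind)
  refine ⟨E, insert c (insert d {a}), hE, hR.isFace_pair, U, hU, hrU, ?_⟩
  intro b hb
  simp only [Finset.mem_insert, Finset.mem_singleton] at hb
  rw [Function.comp_apply]
  rcases hb with rfl | rfl | rfl
  · rwa [Finset.erase_insert hR.notMem_pair, hreflect (by grind) ha]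
  · rwa [Finset.insert_comm, Finset.erase_insert hR.swap_left.notMem_pair, hreflect (by grind) ha]
  · have herase : Finset.erase (insert c (insert d {b})) b = {c, d} := by grind
    rwa [herase, hreflect_cd]

end

variable {x : Finset (Fin n × Bool) → Set P}

theorem isApartment_of_lt (h : X.IsWeakPolarSpace n) (hx : X.IsConfiguration n k x) (hk : 1 ≤ k)
    (hkn : k + 3 ≤ n) : X.IsApartment n k {V | ∃ S, IsFace (k + 1) S ∧ V.1.1 = x S} := by
  by_cases htop : ∀ W, IsFace (k + 2) W → IsTop X k x W
  · obtain ⟨p, hp, hpx⟩ := hx.exists_isFrameMap_of_isTop h hk hkn htop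
    exact hp.isApartment h hx hpx
  push Not at htop
  obtain ⟨W, hW, htW⟩ := htop
  obtain ⟨R, c, d, e, hR, ht⟩ : ∃ R c d e, IsTriple k R c d e ∧ IsTripleTop X k x R c d e := by
    by_contra! hcon
    exact htW (hx.isTop_of_forall_not_isTripleTop h hk hkn hcon hW)
  have hn : n ≤ k + 3 := not_lt.mp fun hlt => hx.not_isTripleTop_of_lt h hlt hR ht
  have hk2 := hx.le_of_isStar h hW ((hx.isTop_or_isStar h hW).resolve_left htW)
  obtain rfl : k = 1 := by lia
  obtain rfl : n = 4 := by lia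
  obtain ⟨E, V, hE, hV, htV⟩ := exists_isTop_comp_reflect hR ht
  have hy := hx.comp_reflect hE
  obtain ⟨p, hp, hpy⟩ := hy.exists_isFrameMap_of_isTop h hk hkn
    fun _ hU => hy.isTop_of_isTop h hk hkn hV hU htV
  convert hp.isApartment h hy hpy using 1
  ext V
  constructor
  · rintro ⟨S, hS, hVS⟩
    exact ⟨reflect E S, isFace_reflect hE hS, by
      rw [hVS, Function.comp_apply, reflect_reflect hE hS]⟩
  · rintro ⟨S, hS, hVS⟩
    exact ⟨reflect E S, isFace_reflect hE hS, hVS⟩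

theorem isApartment (h : X.IsWeakPolarSpace n) (hx : X.IsConfiguration n k x) (hkn : k < n) :
    X.IsApartment n k {V | ∃ S, IsFace (k + 1) S ∧ V.1.1 = x S} := by
  obtain rfl | hk := k.eq_zero_or_pos
  · obtain ⟨p, hp, hpx⟩ := hx.exists_isFrameMap_of_points h
    exact hp.isApartment h hx hpx
  obtain hkn | hkn | hkn : k + 1 = n ∨ k + 2 = n ∨ k + 3 ≤ n := by lia
  · obtain ⟨p, hp, hpx⟩ := hx.exists_isFrameMap_of_maximal h hkn
    exact hp.isApartment h hx hpx
  · have htop W (hW : IsFace (k + 2) W) : IsTop X k x W :=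
      (hx.isTop_or_isStar h hW).resolve_right fun hs => by
        have := hx.le_of_isStar h hW hs
        lia
    obtain ⟨p, hp, hpx⟩ := hx.exists_isFrameMap_of_isTop_of_eq h hkn htop
    exact hp.isApartment h hx hpx
  · exact hx.isApartment_of_lt h hk hkn

end IsConfiguration

end

end PartialLinearSpace

theorem corollary1_general {P Q : Type*} {n k : ℕ} (hk : k < n) {X : PartialLinearSpace P}
    (hX : X.IsWeakPolarSpace n) {T : PartialLinearSpace Q} (hT : T.IsThinPolarSpace n)
    {f : T.Grassmannian k → X.Grassmannian k}
    (hf : ∀ U V, (X.grassmannGraph n k).edist (f U) (f V) = (T.grassmannGraph n k).edist U V) :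
    X.IsApartment n k (Set.range f) := by
  obtain ⟨p, hp⟩ := hT.exists_isThinParam
  obtain ⟨x, hx, hrange⟩ := hp.exists_isConfiguration hX hk hf
  exact hrange ▸ hx.isApartment hX hk

theorem corollary1 {P Q : Type*} (n k : ℕ) (hk : k < n)
    (X : PartialLinearSpace P)
    (hX : (X.IsPolarSpace ∧ X.HasRank n) ∨ X.IsThinPolarSpace n)
    (T : PartialLinearSpace Q) (hT : T.IsThinPolarSpace n)
    (f : T.grassmannGraph n k ↪g X.grassmannGraph n k) (hf : IsIsometricEmbedding f) :
    X.IsApartment n k (Set.range f) := by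
  have h : X.IsWeakPolarSpace n :=
    hX.elim (fun hX => hX.1.isWeakPolarSpace hX.2) fun hX => hX.isWeakPolarSpace
  exact corollary1_general hk h hT hf
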